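/- Let $BV$ be the braided Thompson group. Its elements are the equivalence classes of tree-braid-tree diagrams $(T_+, b, T_-)$, where $T_+$ and $T_-$ are finite rooted binary trees with the same number $n$ of leaves (numbered $0,\dots,n-1$ from left to right) and $b\in B_n$ is a braid whose strands run from the leaves of $T_+$ to the leaves of $T_-$. The equivalence relation is generated by splitting a strand: the strand is replaced by two parallel strands, and a caret is attached to the leaf at each of its two ends. The product of the classes of $(R,a,S)$ and $(S,b,T)$ is the class of $(R,ab,T)$, where $ab$ means first $a$, then $b$. Let $A_k$ be the all-right tree with $k$ carets, and let $X=\{x_0,x_1,\sigma_1,\tau_1\}$, where $x_0$ has trivial braid and branches $00\to 0$, $01\to 10$, $1\to 11$; $x_1$ has trivial braid and branches $0\to 0$, $100\to 10$, $101\to 110$, $11\to 111$; $\sigma_1=(A_2,s,A_2)$ with $s\in B_3$ the elementary crossing of the strands $0$ and $1$; and $\tau_1=(A_1,s',A_1)$ with $s'\in B_2$ the elementary crossing of the two strands. For a group $G$ with finite generating set $X$ and $\delta\in(0,1)$, the $\delta$-divergence function $f_\delta:[0,\infty)\to[0,\infty]$ of the Cayley graph $\mathrm{Cay}(G,X)$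 assigns to $x$ the least $\ell$ such that any two vertices at distance $x$ from the identity can be connected by a path of length at most $\ell$ that avoids the open ball of radius $\delta x$ about the identity ($\infty$ if there is no such $\ell$). For functions $f,g:[0,\infty)\to[0,\infty]$ write $f\preceq g$ if there are constants $A,B,C,D,E\ge 0$ with $f(x)\le A\,g(Bx+C)+Dx+E$ for all $x$, and $f\approx g$ if $f\preceq g$ and $g\preceq f$. Then $X$ generates $BV$, and $BV$ has a linear divergence function: there is $\delta\in(0,1)$ such that the $\delta$-divergence function of $\mathrm{Cay}(BV,X)$ is equivalent ($\approx$) to a linear function $x\mapsto ax$, $a>0$. Moreover, no asymptotic cone of $BV$ (with the word metric of $X$, for any non-principal ultrafilter on $\mathbb N$, any positive scaling constants tending to infinity along it, and any sequence of observation points) has a cut-point, i.e. a point whose complement is disconnected. -/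

import Mathlib

/-- Artin's relations between the elementary braids on `n` strands; the generator `k` crosses the
strands in the positions `k` and `k + 1`, and positions are numbered from `0`. -/
def braidRels (n : ℕ) : Set (FreeGroup (Fin (n - 1))) :=
  {r | ∃ i j : Fin (n - 1), (i : ℕ) + 1 < j ∧
      r = (.of i * .of j) * (.of j * .of i)⁻¹} ∪
  {r | ∃ i j : Fin (n - 1), (i : ℕ) + 1 = j ∧
      r = (.of i * .of j * .of i) * (.of j * .of i * .of j)⁻¹}

/-- The braid group on `n` strands. A product `a * b` is read from left to right: the strands first
run through `a` and then through `b`. -/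
abbrev BraidGroup (n : ℕ) : Type := PresentedGroup (braidRels n)

namespace BraidGroup

/-- The elementary braid that crosses the strands in the positions `k` and `k + 1`
(only used for `k + 1 < n`, with the default value `1` otherwise). -/
def gen (n k : ℕ) : BraidGroup n :=
  if h : k < n - 1 then PresentedGroup.of ⟨k, h⟩ else 1

theorem gen_comm {n i j : ℕ} (h : i + 1 < j) : gen n i * gen n j = gen n j * gen n i := by
  unfold gen
  split_ifs with h1 h2 h2
  · rw [← mul_inv_eq_one]
    exact PresentedGroup.one_of_mem (rels := braidRels n) (Or.inl ⟨⟨i, h1⟩, ⟨j, h2⟩, h, rfl⟩)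
  all_goals simp

theorem gen_braid {n i : ℕ} (h : i + 2 < n) :
    gen n i * gen n (i + 1) * gen n i = gen n (i + 1) * gen n i * gen n (i + 1) := by
  unfold gen
  rw [dif_pos (by omega), dif_pos (by omega), ← mul_inv_eq_one]
  exact PresentedGroup.one_of_mem (rels := braidRels n)
    (Or.inr ⟨⟨i, by omega⟩, ⟨i + 1, by omega⟩, rfl, rfl⟩)

/-- A map on generators extends to the braid group if it respects Artin's relations. -/
def lift {n : ℕ} {H : Type} [Group H] (f : ℕ → H)
    (h1 : ∀ i j, i + 1 < j → j + 1 < n → f i * f j = f j * f i)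
    (h2 : ∀ i, i + 2 < n → f i * f (i + 1) * f i = f (i + 1) * f i * f (i + 1)) :
    BraidGroup n →* H :=
  PresentedGroup.toGroup (f := fun k : Fin (n - 1) => f k) (by
    rintro r (⟨i, j, hij, rfl⟩ | ⟨i, j, hij, rfl⟩)
    · have := h1 i j hij (by omega)
      simp only [map_mul, map_inv, FreeGroup.lift_apply_of, mul_inv_eq_one]
      exact this
    · have := h2 i (by omega)
      simp only [map_mul, map_inv, FreeGroup.lift_apply_of, mul_inv_eq_one, ← hij]
      exact this)

theorem lift_gen {n : ℕ} {H : Type} [Group H] (f : ℕ → H)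
    (h1 : ∀ i j, i + 1 < j → j + 1 < n → f i * f j = f j * f i)
    (h2 : ∀ i, i + 2 < n → f i * f (i + 1) * f i = f (i + 1) * f i * f (i + 1))
    {k : ℕ} (hk : k + 1 < n) : lift f h1 h2 (gen n k) = f k := by
  unfold gen lift
  rw [dif_pos (by omega), PresentedGroup.toGroup.of]

theorem gen_induction {n : ℕ} {P : BraidGroup n → Prop} (hg : ∀ k, k + 1 < n → P (gen n k))
    (h1 : P 1) (hm : ∀ a b, P a → P b → P (a * b)) (hi : ∀ a, P a → P a⁻¹) (b : BraidGroup n) :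
    P b := by
  have hb : b ∈ Subgroup.closure (Set.range (PresentedGroup.of (rels := braidRels n))) := by
    rw [PresentedGroup.closure_range_of]; trivial
  induction hb using Subgroup.closure_induction with
  | mem x hx =>
    obtain ⟨k, rfl⟩ := hx
    have := hg k (by omega)
    rwa [gen, dif_pos (by omega)] at this
  | one => exact h1
  | mul a b _ _ ha hb => exact hm a b ha hb
  | inv a _ ha => exact hi a ha

/-- The underlying permutation of a braid: the strand that starts at the position `i` ends at the
position `perm b i`. Products of braids are read from left to right, hence the opposite group. -/
def permHom (n : ℕ) : BraidGroup n →* (Equiv.Perm ℕ)ᵐᵒᵖ :=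
  lift (fun k => MulOpposite.op (Equiv.swap k (k + 1)))
    (by
      intro i j hij _
      rw [← MulOpposite.op_mul, ← MulOpposite.op_mul]
      congr 1; ext x; simp only [Equiv.Perm.mul_apply, Equiv.swap_apply_def]; split_ifs <;> omega)
    (by
      intro i _
      rw [← MulOpposite.op_mul, ← MulOpposite.op_mul, ← MulOpposite.op_mul, ← MulOpposite.op_mul]
      congr 1; ext x; simp only [Equiv.Perm.mul_apply, Equiv.swap_apply_def]; split_ifs <;> omega)

/-- The underlying permutation of a braid. -/
def perm {n : ℕ} (b : BraidGroup n) : Equiv.Perm ℕ := (permHom n b).unop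

theorem perm_gen {n k : ℕ} (hk : k + 1 < n) : perm (gen n k) = Equiv.swap k (k + 1) := by
  unfold perm permHom; rw [lift_gen _ _ _ hk]; rfl

@[simp] theorem perm_one {n : ℕ} : perm (1 : BraidGroup n) = 1 := by simp [perm]

@[simp] theorem perm_mul {n : ℕ} (a b : BraidGroup n) (i : ℕ) :
    perm (a * b) i = perm b (perm a i) := by simp [perm]

@[simp] theorem perm_inv {n : ℕ} (a : BraidGroup n) : perm a⁻¹ = (perm a)⁻¹ := by simp [perm]

theorem perm_lt {n : ℕ} (b : BraidGroup n) (i : ℕ) : perm b i < n ↔ i < n := by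
  induction b using gen_induction generalizing i with
  | hg k hk =>
    rw [perm_gen hk, Equiv.swap_apply_def]; split_ifs <;> omega
  | h1 => simp
  | hm a b ha hb => rw [perm_mul, hb, ha]
  | hi a ha => rw [perm_inv, ← ha]; simp

/-- The braid on `m + 1` strands obtained from the elementary braid that crosses the strands `k`
and `k + 1` among `m` strands by splitting the strand that starts at the position `i` into two
parallel strands. -/
def splitGen (m k i : ℕ) : BraidGroup (m + 1) :=
  if i < k then gen (m + 1) (k + 1)
  else if i = k then gen (m + 1) (k + 1) * gen (m + 1) k
  else if i = k + 1 then gen (m + 1) k * gen (m + 1) (k + 1)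
  else gen (m + 1) k

/-- The permutation of pairs (position of a strand, braid on `m + 1` strands) that moves the strand
through an elementary braid and records the split elementary braid on the right. -/
def splitStep (m k : ℕ) : Equiv.Perm (ℕ × BraidGroup (m + 1)) where
  toFun q := (Equiv.swap k (k + 1) q.1, q.2 * splitGen m k q.1)
  invFun q := (Equiv.swap k (k + 1) q.1, q.2 * (splitGen m k (Equiv.swap k (k + 1) q.1))⁻¹)
  left_inv q := by simp
  right_inv q := by simp

theorem splitStep_lt {m k i : ℕ} {b : BraidGroup (m + 1)} (h : i < k) :
    splitStep m k (i, b) = (i, b * gen (m + 1) (k + 1)) := by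
  simp only [splitStep, Equiv.coe_fn_mk, splitGen, if_pos h]
  rw [Equiv.swap_apply_of_ne_of_ne (by omega) (by omega)]

theorem splitStep_left {m k : ℕ} {b : BraidGroup (m + 1)} :
    splitStep m k (k, b) = (k + 1, b * (gen (m + 1) (k + 1) * gen (m + 1) k)) := by
  simp [splitStep, splitGen]

theorem splitStep_right {m k : ℕ} {b : BraidGroup (m + 1)} :
    splitStep m k (k + 1, b) = (k, b * (gen (m + 1) k * gen (m + 1) (k + 1))) := by
  simp [splitStep, splitGen]

theorem splitStep_gt {m k i : ℕ} {b : BraidGroup (m + 1)} (h : k + 1 < i) :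
    splitStep m k (i, b) = (i, b * gen (m + 1) k) := by
  simp only [splitStep, Equiv.coe_fn_mk, splitGen]
  rw [Equiv.swap_apply_of_ne_of_ne (by omega) (by omega), if_neg (by omega), if_neg (by omega),
    if_neg (by omega)]

theorem splitStep_comm {m i j : ℕ} (hij : i + 1 < j) (x : ℕ) (b : BraidGroup (m + 1)) :
    splitStep m j (splitStep m i (x, b)) = splitStep m i (splitStep m j (x, b)) := by
  have e1 : Commute (gen (m + 1) i) (gen (m + 1) j) := gen_comm (by omega)
  have e2 : Commute (gen (m + 1) i) (gen (m + 1) (j + 1)) := gen_comm (by omega)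
  have e3 : Commute (gen (m + 1) (i + 1)) (gen (m + 1) (j + 1)) := gen_comm (by omega)
  have hx : x < i ∨ x = i ∨ x = i + 1 ∨ (i + 1 < x ∧ x < j) ∨ x = j ∨ x = j + 1 ∨ j + 1 < x := by
    omega
  rcases hx with hx | rfl | rfl | hx | rfl | rfl | hx <;>
    simp (disch := omega) only [splitStep_lt, splitStep_left, splitStep_right, splitStep_gt,
      Prod.mk.injEq, mul_assoc b, mul_right_inj, true_and]
  · exact e3
  · exact e3.mul_left e2
  · exact e2.mul_left e3
  · exact e2
  · exact e2.mul_right e1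
  · exact e1.mul_right e2
  · exact e1

theorem splitStep_braid {m i : ℕ} (hi : i + 2 < m) (x : ℕ) (y : BraidGroup (m + 1)) :
    splitStep m i (splitStep m (i + 1) (splitStep m i (x, y))) =
      splitStep m (i + 1) (splitStep m i (splitStep m (i + 1) (x, y))) := by
  have e : gen (m + 1) i * gen (m + 1) (i + 1 + 1) = gen (m + 1) (i + 1 + 1) * gen (m + 1) i :=
    gen_comm (by omega)
  have b1 := gen_braid (n := m + 1) (i := i) (by omega)
  have b2 := gen_braid (n := m + 1) (i := i + 1) (by omega)
  have hx : x < i ∨ x = i ∨ x = i + 1 ∨ x = i + 1 + 1 ∨ i + 2 < x := by omega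
  rcases hx with hx | rfl | rfl | rfl | hx <;>
    simp (disch := omega) only [splitStep_lt, splitStep_left, splitStep_right, splitStep_gt,
      Prod.mk.injEq, mul_assoc y, mul_right_inj, true_and]
  · exact b2
  · generalize gen (m + 1) x = a at *
    generalize gen (m + 1) (x + 1) = b at *
    generalize gen (m + 1) (x + 1 + 1) = c at *
    calc b * a * (c * b) * a = b * (a * c) * b * a := by group
      _ = b * c * (a * b * a) := by rw [e]; group
      _ = (b * c * b) * a * b := by rw [b1]; group
      _ = c * b * (c * a) * b := by rw [b2]; group
      _ = c * (b * a) * (c * b) := by rw [← e]; group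
  · generalize gen (m + 1) i = a at *
    generalize gen (m + 1) (i + 1) = b at *
    generalize gen (m + 1) (i + 1 + 1) = c at *
    calc a * b * c * (b * a) = a * (b * c * b) * a := by group
      _ = (a * c) * b * (c * a) := by rw [b2]; group
      _ = (c * a) * b * (a * c) := by rw [e]
      _ = c * (a * b * a) * c := by group
      _ = c * b * a * (b * c) := by rw [b1]; group
  · generalize gen (m + 1) i = a at *
    generalize gen (m + 1) (i + 1) = b at *
    generalize gen (m + 1) (i + 1 + 1) = c at *
    calc a * (b * c) * (a * b) = a * b * (c * a) * b := by group
      _ = (a * b * a) * c * b := by rw [← e]; group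
      _ = b * a * (b * c * b) := by rw [b1]; group
      _ = b * (a * c) * b * c := by rw [b2]; group
      _ = b * c * (a * b) * c := by rw [e]; group
  · exact b1

/-- The action of braids on pairs that is used to define the splitting of a strand. -/
def splitHom (n : ℕ) : BraidGroup n →* (Equiv.Perm (ℕ × BraidGroup (n + 1)))ᵐᵒᵖ :=
  lift (fun k => MulOpposite.op (splitStep n k))
    (by
      intro i j hij _
      rw [← MulOpposite.op_mul, ← MulOpposite.op_mul]
      exact congrArg _ (Equiv.ext fun q => splitStep_comm hij q.1 q.2))
    (by
      intro i hi
      rw [← MulOpposite.op_mul, ← MulOpposite.op_mul, ← MulOpposite.op_mul, ← MulOpposite.op_mul]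
      exact congrArg _ (Equiv.ext fun q => splitStep_braid hi q.1 q.2))

/-- The splitting of the strand of the braid `b` that starts at the position `i`: a parallel strand
is inserted immediately to the right of it. It is given on elementary braids by `splitGen`, and in a
product `a * b` the strand that starts at `i` is split in `a` and then, from the position
`perm a i` on, in `b`. -/
def split {n : ℕ} (i : ℕ) (b : BraidGroup n) : BraidGroup (n + 1) :=
  ((splitHom n b).unop (i, 1)).2

theorem splitHom_apply {n : ℕ} (b : BraidGroup n) (i : ℕ) (c : BraidGroup (n + 1)) :
    (splitHom n b).unop (i, c) = (perm b i, c * split i b) := by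
  have key : ∀ i c, ((splitHom n b).unop (i, c)).1 = perm b i ∧
      ((splitHom n b).unop (i, c)).2 = c * ((splitHom n b).unop (i, 1)).2 := by
    induction b using gen_induction with
    | hg k hk =>
      intro i c
      rw [perm_gen hk]
      unfold splitHom
      rw [lift_gen _ _ _ hk]
      simp [splitStep]
    | h1 => simp
    | hm a b ha hb =>
      intro i c
      have h (i c) : (splitHom n a).unop (i, c) =
        (perm a i, c * ((splitHom n a).unop (i, 1)).2) := Prod.ext (ha i c).1 (ha i c).2
      have h' (i c) : (splitHom n b).unop (i, c) =
        (perm b i, c * ((splitHom n b).unop (i, 1)).2) := Prod.ext (hb i c).1 (hb i c).2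
      simp only [map_mul, MulOpposite.unop_mul, Equiv.Perm.mul_apply, perm_mul]
      rw [h i c, h' _ _, h i 1, h' _ (1 * _)]
      simp [mul_assoc]
    | hi a ha =>
      intro i c
      have h (i c) : (splitHom n a)⁻¹.unop (i, c) =
          ((perm a)⁻¹ i, c * (((splitHom n a).unop ((perm a)⁻¹ i, 1)).2)⁻¹) := by
        rw [MulOpposite.unop_inv, Equiv.Perm.inv_eq_iff_eq]
        refine Prod.ext ?_ ?_
        · rw [(ha _ _).1]; simp
        · rw [(ha _ _).2]; simp
      rw [map_inv, h, h, perm_inv]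
      simp
  exact Prod.ext (key i c).1 (key i c).2

theorem split_gen {n k : ℕ} (i : ℕ) (hk : k + 1 < n) : split i (gen n k) = splitGen n k i := by
  unfold split splitHom; rw [lift_gen _ _ _ hk]; simp [splitStep]

@[simp] theorem split_one {n : ℕ} (i : ℕ) : split i (1 : BraidGroup n) = 1 := by simp [split]

theorem split_mul {n : ℕ} (i : ℕ) (a b : BraidGroup n) :
    split i (a * b) = split i a * split (perm a i) b := by
  have := splitHom_apply (a * b) i 1
  rw [map_mul, MulOpposite.unop_mul, Equiv.Perm.mul_apply, splitHom_apply, splitHom_apply] at this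
  simpa using (congrArg Prod.snd this).symm

theorem split_inv {n : ℕ} (i : ℕ) (a : BraidGroup n) :
    split (perm a i) a⁻¹ = (split i a)⁻¹ := by
  have := split_mul i a a⁻¹
  rw [mul_inv_cancel, split_one] at this
  exact (inv_eq_of_mul_eq_one_right this.symm).symm

/-- The new position of the strand (or leaf) number `j` after number `i` has been split. -/
def up (i j : ℕ) : ℕ := if j ≤ i then j else j + 1

theorem perm_split {n : ℕ} (b : BraidGroup n) {i j : ℕ} (hij : i ≠ j) :
    perm (split i b) (up i j) = up (perm b i) (perm b j) := by
  induction b using gen_induction generalizing i j with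
  | hg k hk =>
    have p1 := perm_gen (n := n + 1) (k := k) (by omega)
    have p2 := perm_gen (n := n + 1) (k := k + 1) (by omega)
    rw [split_gen _ hk, perm_gen hk, splitGen]
    split_ifs <;> simp only [perm_mul, p1, p2, up, Equiv.swap_apply_def] <;> grind
  | h1 => simp
  | hm a b ha hb =>
    rw [split_mul, perm_mul, ha hij, hb ((perm a).injective.ne hij), perm_mul, perm_mul]
  | hi a ha =>
    obtain ⟨i, rfl⟩ := (perm a).surjective i
    obtain ⟨j, rfl⟩ := (perm a).surjective j
    rw [split_inv, perm_inv, perm_inv, Equiv.Perm.inv_eq_iff_eq]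
    rw [Equiv.Perm.inv_def, Equiv.symm_apply_apply, Equiv.symm_apply_apply]
    exact (ha (fun h : i = j => hij (h ▸ rfl))).symm

theorem split_gen_lt {n k i : ℕ} (hk : k + 1 < n) (h : i < k) :
    split i (gen n k) = gen (n + 1) (k + 1) := by
  rw [split_gen _ hk, splitGen, if_pos h]

theorem split_gen_left {n k : ℕ} (hk : k + 1 < n) :
    split k (gen n k) = gen (n + 1) (k + 1) * gen (n + 1) k := by
  rw [split_gen _ hk, splitGen, if_neg (by omega), if_pos rfl]

theorem split_gen_right {n k : ℕ} (hk : k + 1 < n) :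
    split (k + 1) (gen n k) = gen (n + 1) k * gen (n + 1) (k + 1) := by
  rw [split_gen _ hk, splitGen, if_neg (by omega), if_neg (by omega), if_pos rfl]

theorem split_gen_gt {n k i : ℕ} (hk : k + 1 < n) (h : k + 1 < i) :
    split i (gen n k) = gen (n + 1) k := by
  rw [split_gen _ hk, splitGen, if_neg (by omega), if_neg (by omega), if_neg (by omega)]

theorem perm_gen_left {n k : ℕ} (hk : k + 1 < n) : perm (gen n k) k = k + 1 := by
  rw [perm_gen hk, Equiv.swap_apply_left]

theorem perm_gen_right {n k : ℕ} (hk : k + 1 < n) : perm (gen n k) (k + 1) = k := by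
  rw [perm_gen hk, Equiv.swap_apply_right]

theorem perm_gen_lt {n k i : ℕ} (hk : k + 1 < n) (h : i < k) : perm (gen n k) i = i := by
  rw [perm_gen hk, Equiv.swap_apply_of_ne_of_ne (by omega) (by omega)]

theorem perm_gen_gt {n k i : ℕ} (hk : k + 1 < n) (h : k + 1 < i) : perm (gen n k) i = i := by
  rw [perm_gen hk, Equiv.swap_apply_of_ne_of_ne (by omega) (by omega)]

theorem split_split_gen {n k : ℕ} (hk : k + 1 < n) {i j : ℕ} (hij : i < j) :
    split (j + 1) (split i (gen n k)) = split i (split j (gen n k)) := by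
  have e : gen (n + 1 + 1) k * gen (n + 1 + 1) (k + 1 + 1) =
    gen (n + 1 + 1) (k + 1 + 1) * gen (n + 1 + 1) k := gen_comm (by omega)
  have hx : (i < k ∧ j < k) ∨ (i < k ∧ j = k) ∨ (i < k ∧ j = k + 1) ∨ (i < k ∧ k + 1 < j) ∨
      (i = k ∧ j = k + 1) ∨ (i = k ∧ k + 1 < j) ∨ (i = k + 1 ∧ k + 1 < j) ∨ k + 1 < i := by omega
  rcases hx with ⟨h, h'⟩ | ⟨h, rfl⟩ | ⟨h, rfl⟩ | ⟨h, h'⟩ | ⟨rfl, rfl⟩ | ⟨rfl, h'⟩ | ⟨rfl, h'⟩ | h <;>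
    simp (disch := omega) only [split_mul, split_gen_lt, split_gen_left, split_gen_right,
      split_gen_gt, perm_gen_lt, perm_gen_left, perm_gen_right, perm_gen_gt]
  generalize gen (n + 1 + 1) i = a at *
  generalize gen (n + 1 + 1) (i + 1) = b at *
  generalize gen (n + 1 + 1) (i + 1 + 1) = c at *
  calc b * c * (a * b) = b * (c * a) * b := by group
    _ = b * a * (c * b) := by rw [← e]; group

/-- Splitting two different strands in either order gives the same braid. -/
theorem split_split {n : ℕ} (b : BraidGroup n) {i j : ℕ} (hij : i ≠ j) :
    split (up i j) (split i b) = split (up j i) (split j b) := by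
  induction b using gen_induction generalizing i j with
  | hg k hk =>
    rcases lt_or_gt_of_ne hij with h | h
    · rw [up, if_neg (by omega), up, if_pos (by omega), split_split_gen hk h]
    · rw [up, if_pos (by omega), up, if_neg (by omega), split_split_gen hk h]
  | h1 => simp
  | hm a b ha hb =>
    rw [split_mul, split_mul, split_mul, split_mul, perm_split a hij, perm_split a hij.symm,
      ha hij, hb ((perm a).injective.ne hij)]
  | hi a ha =>
    obtain ⟨i, rfl⟩ := (perm a).surjective i
    obtain ⟨j, rfl⟩ := (perm a).surjective j
    have h : i ≠ j := fun h => hij (h ▸ rfl)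
    rw [split_inv, split_inv, ← perm_split a h, ← perm_split a h.symm, split_inv, split_inv, ha h]

end BraidGroup

/-- Finite rooted binary trees, in which every vertex that is not a leaf has a left and a right
child. The leaves are numbered from left to right, starting with `0`. -/
abbrev BVTree : Type := BinaryTree Unit

namespace BVTree

open BraidGroup (up)

/-- Attach a caret to the leaf number `i`. -/
def attach : BVTree → ℕ → BVTree
  | .nil, i => if i = 0 then .node () .nil .nil else .nil
  | .node _ l r, i =>
    if i < l.numLeaves then .node () (attach l i) r else .node () l (attach r (i - l.numLeaves))

theorem numLeaves_attach {T : BVTree} {i : ℕ} (h : i < T.numLeaves) :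
    (attach T i).numLeaves = T.numLeaves + 1 := by
  induction T generalizing i with
  | nil => simp only [BinaryTree.numLeaves] at h; simp [attach, show i = 0 by omega]
  | node _ l r hl hr =>
    simp only [BinaryTree.numLeaves] at h
    rw [attach]
    split_ifs with h1
    · simp [hl h1]; omega
    · simp [hr (i := i - l.numLeaves) (by omega)]; omega

theorem attach_attach {T : BVTree} {i j : ℕ} (hi : i < T.numLeaves) (hj : j < T.numLeaves)
    (hij : i < j) : attach (attach T i) (j + 1) = attach (attach T j) i := by
  induction T generalizing i j with
  | nil => simp only [BinaryTree.numLeaves] at hi hj; omega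
  | node _ l r hl hr =>
    simp only [BinaryTree.numLeaves] at hi hj
    by_cases h1 : i < l.numLeaves
    · by_cases h2 : j < l.numLeaves
      · simp only [attach, h1, h2, if_true, numLeaves_attach]
        rw [if_pos (by omega), if_pos (by omega), hl h1 h2 hij]
      · simp only [attach, h1, h2, if_true, if_false, numLeaves_attach]
        rw [if_neg (by omega), Nat.add_sub_add_right]
    · have h2 : ¬ j < l.numLeaves := by omega
      simp only [attach, h1, h2, if_false]
      rw [if_neg (by omega), ← hr (i := i - l.numLeaves) (j := j - l.numLeaves) (by omega) (by omega)
        (by omega)]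
      congr 2; omega

theorem attach_comm {T : BVTree} {i j : ℕ} (hi : i < T.numLeaves) (hj : j < T.numLeaves)
    (hij : i ≠ j) : attach (attach T i) (up i j) = attach (attach T j) (up j i) := by
  rcases lt_or_gt_of_ne hij with h | h
  · rw [up, if_neg (by omega), up, if_pos (by omega), attach_attach hi hj h]
  · rw [up, if_pos (by omega), up, if_neg (by omega), attach_attach hj hi h]

/-- `Le T S`: the tree `T` is a rooted subtree of `S`. -/
def Le : BVTree → BVTree → Prop
  | .nil, _ => True
  | .node _ _ _, .nil => False
  | .node _ l r, .node _ l' r' => Le l l' ∧ Le r r'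

theorem Le.refl (T : BVTree) : Le T T := by
  induction T with
  | nil => trivial
  | node _ l r hl hr => exact ⟨hl, hr⟩

theorem Le.trans {T S U : BVTree} (h : Le T S) (h' : Le S U) : Le T U := by
  induction T generalizing S U with
  | nil => trivial
  | node _ l r hl hr =>
    cases S with
    | nil => exact h.elim
    | node _ _ _ =>
      cases U with
      | nil => exact h'.elim
      | node _ _ _ => exact ⟨hl h.1 h'.1, hr h.2 h'.2⟩

theorem Le.numLeaves {T S : BVTree} (h : Le T S) :
    T.numLeaves ≤ S.numLeaves ∧ (T.numLeaves = S.numLeaves → T = S) := by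
  induction T generalizing S with
  | nil =>
    cases S with
    | nil => simp
    | node _ l r =>
      have := l.numLeaves_pos
      have := r.numLeaves_pos
      simp only [BinaryTree.numLeaves]
      exact ⟨by omega, by omega⟩
  | node _ l r hl hr =>
    cases S with
    | nil => exact h.elim
    | node _ l' r' =>
      have a := hl h.1
      have b := hr h.2
      simp only [BinaryTree.numLeaves]
      refine ⟨by omega, fun e => ?_⟩
      rw [a.2 (by omega), b.2 (by omega)]

theorem le_attach (T : BVTree) (i : ℕ) : Le T (attach T i) := by
  induction T generalizing i with
  | nil => trivial
  | node _ l r hl hr =>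
    rw [attach]
    split_ifs
    · exact ⟨hl _, Le.refl _⟩
    · exact ⟨Le.refl _, hr _⟩

theorem exists_attach_le {T S : BVTree} (h : Le T S) (hne : T ≠ S) :
    ∃ i < T.numLeaves, Le (attach T i) S := by
  induction T generalizing S with
  | nil =>
    cases S with
    | nil => exact absurd rfl hne
    | node _ l r => exact ⟨0, by simp, by simp [attach, Le]⟩
  | node _ l r hl hr =>
    cases S with
    | nil => exact h.elim
    | node _ l' r' =>
      by_cases e : l = l'
      · have e' : r ≠ r' := fun e' => hne (by rw [e, e'])
        obtain ⟨i, hi, h2⟩ := hr h.2 e'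
        refine ⟨i + l.numLeaves, by simp only [BinaryTree.numLeaves]; omega, ?_⟩
        rw [attach, if_neg (by omega), Nat.add_sub_cancel]
        exact ⟨h.1, h2⟩
      · obtain ⟨i, hi, h2⟩ := hl h.1 e
        refine ⟨i, by simp only [BinaryTree.numLeaves]; omega, ?_⟩
        rw [attach, if_pos hi]
        exact ⟨h2, h.2⟩

theorem attach_attach_le {T S : BVTree} {i j : ℕ} (hi : i < T.numLeaves) (hj : j < T.numLeaves)
    (hij : i < j) (h : Le (attach T i) S) (h' : Le (attach T j) S) :
    Le (attach (attach T i) (j + 1)) S := by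
  induction T generalizing S i j with
  | nil => simp only [BinaryTree.numLeaves] at hi hj; omega
  | node _ l r hl hr =>
    simp only [BinaryTree.numLeaves] at hi hj
    cases S with
    | nil => rw [attach] at h; split_ifs at h <;> exact h.elim
    | node _ l' r' =>
      by_cases h1 : i < l.numLeaves
      · by_cases h2 : j < l.numLeaves
        · simp only [attach, h1, h2, if_true, numLeaves_attach] at h h' ⊢
          rw [if_pos (by omega)]
          exact ⟨hl h1 h2 hij h.1 h'.1, h.2⟩
        · simp only [attach, h1, h2, if_true, if_false, numLeaves_attach] at h h' ⊢
          rw [if_neg (by omega), Nat.add_sub_add_right]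
          exact ⟨h.1, h'.2⟩
      · have h2 : ¬ j < l.numLeaves := by omega
        simp only [attach, h1, h2, if_false] at h h' ⊢
        rw [if_neg (by omega), show j + 1 - l.numLeaves = j - l.numLeaves + 1 by omega]
        exact ⟨h.1, hr (by omega) (by omega) (by omega) h.2 h'.2⟩

theorem attach_up_le {T S : BVTree} {i j : ℕ} (hi : i < T.numLeaves) (hj : j < T.numLeaves)
    (hij : i ≠ j) (h : Le (attach T i) S) (h' : Le (attach T j) S) :
    Le (attach (attach T i) (up i j)) S := by
  rcases lt_or_gt_of_ne hij with e | e
  · rw [up, if_neg (by omega)]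
    exact attach_attach_le hi hj e h h'
  · rw [attach_comm hi hj hij, up, if_neg (by omega)]
    exact attach_attach_le hj hi e h' h

theorem exists_le (T S : BVTree) : ∃ U, Le T U ∧ Le S U := by
  induction T generalizing S with
  | nil => exact ⟨S, trivial, Le.refl _⟩
  | node _ l r hl hr =>
    cases S with
    | nil => exact ⟨_, Le.refl _, trivial⟩
    | node _ l' r' =>
      obtain ⟨a, ha, ha'⟩ := hl l'
      obtain ⟨b, hb, hb'⟩ := hr r'
      exact ⟨.node () a b, ⟨ha, hb⟩, ⟨ha', hb'⟩⟩

end BVTree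

open BraidGroup (up) in
theorem up_lt {i j n : ℕ} (h : j < n) : up i j < n + 1 := by
  unfold up; split_ifs <;> omega

/-- A tree-braid-tree diagram `(dom, braid, ran)`: two binary trees with the same number of leaves
and a braid, whose strands lead from the leaves of `dom` to the leaves of `ran`. -/
structure TBTDiagram where
  /-- The number of leaves of both trees, and the number of strands. -/
  n : ℕ
  /-- The domain tree. -/
  dom : BVTree
  /-- The range tree. -/
  ran : BVTree
  /-- The braid. -/
  braid : BraidGroup n
  dom_leaves : dom.numLeaves = n
  ran_leaves : ran.numLeaves = n

namespace TBTDiagram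

open Relation BraidGroup

/-- Splitting of the strand that starts at the leaf number `i` of the domain tree: carets are
attached to both ends of the strand, and the strand is replaced by two parallel ones. -/
def split (D : TBTDiagram) (i : ℕ) (hi : i < D.n) : TBTDiagram where
  n := D.n + 1
  dom := D.dom.attach i
  ran := D.ran.attach (perm D.braid i)
  braid := BraidGroup.split i D.braid
  dom_leaves := by rw [BVTree.numLeaves_attach (by rw [D.dom_leaves]; exact hi), D.dom_leaves]
  ran_leaves := by
    rw [BVTree.numLeaves_attach (by rw [D.ran_leaves, perm_lt]; exact hi), D.ran_leaves]

/-- `Splits D E`: the diagram `E` is obtained from `D` by splitting one strand, or in other words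
`D` is obtained from `E` by a reduction of carets. -/
def Splits (D E : TBTDiagram) : Prop := ∃ (i : ℕ) (hi : i < D.n), E = D.split i hi

theorem split_split (D : TBTDiagram) {i j : ℕ} (hi : i < D.n) (hj : j < D.n) (hij : i ≠ j) :
    (D.split i hi).split (up i j) (up_lt hj) = (D.split j hj).split (up j i) (up_lt hi) := by
  simp only [split, mk.injEq, heq_eq_eq, true_and]
  refine ⟨?_, ?_, BraidGroup.split_split _ hij⟩
  · exact BVTree.attach_comm (by rwa [D.dom_leaves]) (by rwa [D.dom_leaves]) hij
  · rw [perm_split _ hij, perm_split _ hij.symm]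
    exact BVTree.attach_comm (by rwa [D.ran_leaves, perm_lt]) (by rwa [D.ran_leaves, perm_lt])
      ((perm _).injective.ne hij)

theorem splits_confluent (D E F : TBTDiagram) (h : Splits D E) (h' : Splits D F) :
    ∃ K, ReflGen Splits E K ∧ ReflTransGen Splits F K := by
  obtain ⟨i, hi, rfl⟩ := h
  obtain ⟨j, hj, rfl⟩ := h'
  by_cases hij : i = j
  · subst hij; exact ⟨_, .refl, .refl⟩
  · exact ⟨_, .single ⟨_, up_lt hj, rfl⟩, .single ⟨_, up_lt hi, split_split D hi hj hij⟩⟩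

theorem join_of_eqvGen {D E : TBTDiagram} (h : EqvGen Splits D E) :
    ∃ K, ReflTransGen Splits D K ∧ ReflTransGen Splits E K := by
  have := equivalence_join_reflTransGen splits_confluent
  exact this.eqvGen_iff.1 (EqvGen.mono (fun a b h => ⟨b, .single h, .refl⟩) _ _ h)

theorem le_of_splits {D E : TBTDiagram} (h : ReflTransGen Splits D E) :
    BVTree.Le D.dom E.dom ∧ (D.n = E.n → D = E) ∧ D.n ≤ E.n := by
  induction h with
  | refl => exact ⟨BVTree.Le.refl _, fun _ => rfl, le_rfl⟩
  | tail h1 h2 ih =>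
    obtain ⟨i, hi, rfl⟩ := h2
    have := ih.2.2
    refine ⟨ih.1.trans (BVTree.le_attach _ _), fun e => ?_, ?_⟩ <;> simp only [split] at * <;> omega

theorem exists_splits {S : BVTree} (k : ℕ) (D : TBTDiagram) (hk : S.numLeaves = D.n + k)
    (h : BVTree.Le D.dom S) : ∃ E, ReflTransGen Splits D E ∧ E.dom = S := by
  induction k generalizing D with
  | zero => exact ⟨D, .refl, h.numLeaves.2 (by rw [D.dom_leaves]; omega)⟩
  | succ k ih =>
    obtain ⟨i, hi, h'⟩ := BVTree.exists_attach_le h (by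
      rintro rfl; have := D.dom_leaves; omega)
    rw [D.dom_leaves] at hi
    obtain ⟨E, h1, h2⟩ := ih (D.split i hi) (by simp only [split]; omega) h'
    exact ⟨E, .head ⟨i, hi, rfl⟩ h1, h2⟩

theorem exists_splits_dom (D : TBTDiagram) {S : BVTree} (h : BVTree.Le D.dom S) :
    ∃ E, ReflTransGen Splits D E ∧ E.dom = S := by
  have := h.numLeaves.1
  rw [D.dom_leaves] at this
  exact exists_splits (S.numLeaves - D.n) D (by omega) h

theorem splits_unique_aux (k : ℕ) (D E F : TBTDiagram) (hk : E.n = D.n + k)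
    (hE : ReflTransGen Splits D E) (hF : ReflTransGen Splits D F) (h : E.dom = F.dom) : E = F := by
  have hn : E.n = F.n := by rw [← E.dom_leaves, ← F.dom_leaves, h]
  induction k generalizing D E F with
  | zero => rw [← (le_of_splits hE).2.1 (by omega), ← (le_of_splits hF).2.1 (by omega)]
  | succ k ih =>
    rcases hE.cases_head with rfl | ⟨D1, ⟨i, hi, rfl⟩, h1⟩
    · omega
    rcases hF.cases_head with rfl | ⟨D2, ⟨j, hj, rfl⟩, h2⟩
    · omega
    by_cases hij : i = j
    · subst hij
      exact ih _ _ _ (by simp only [split]; omega) h1 h2 h hn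
    · have l1 := (le_of_splits h1).1
      have l2 := (le_of_splits h2).1
      rw [← h] at l2
      obtain ⟨X, hX, hX'⟩ := exists_splits_dom ((D.split i hi).split (up i j) (up_lt hj))
        (BVTree.attach_up_le (by rwa [D.dom_leaves]) (by rwa [D.dom_leaves]) hij l1 l2)
      have hn' : X.n = E.n := by rw [← X.dom_leaves, ← E.dom_leaves, hX']
      have a : E = X := ih (D.split i hi) _ _ (by simp only [split]; omega) h1
        (.head ⟨_, up_lt hj, rfl⟩ hX) hX'.symm hn'.symm
      have b : F = X := ih (D.split j hj) _ _ (by simp only [split]; omega) h2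
        (.head ⟨_, up_lt hi, split_split D hi hj hij⟩ hX) (by rw [← h, hX']) (by omega)
      rw [a, b]

theorem splits_unique {D E F : TBTDiagram} (hE : ReflTransGen Splits D E)
    (hF : ReflTransGen Splits D F) (h : E.dom = F.dom) : E = F :=
  splits_unique_aux (E.n - D.n) D E F (by have := (le_of_splits hE).2.2; omega) hE hF h

/-- The diagram that is turned upside down. -/
def inv (D : TBTDiagram) : TBTDiagram :=
  ⟨D.n, D.ran, D.dom, D.braid⁻¹, D.ran_leaves, D.dom_leaves⟩

theorem inv_inv (D : TBTDiagram) : D.inv.inv = D := by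
  obtain ⟨n, R, S, a, hR, hS⟩ := D
  exact congrArg (fun c => TBTDiagram.mk n R S c hR hS) (_root_.inv_inv a)

theorem Splits.inv {D E : TBTDiagram} (h : Splits D E) : Splits D.inv E.inv := by
  obtain ⟨i, hi, rfl⟩ := h
  refine ⟨perm D.braid i, (perm_lt _ _).2 hi, ?_⟩
  simp only [TBTDiagram.inv, split, split_inv, perm_inv, mk.injEq, heq_eq_eq, true_and]
  rw [Equiv.Perm.inv_def, Equiv.symm_apply_apply]
  exact ⟨rfl, rfl⟩

theorem splits_inv {D E : TBTDiagram} (h : ReflTransGen Splits D E) :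
    ReflTransGen Splits D.inv E.inv := by
  induction h with
  | refl => exact .refl
  | tail _ h2 ih => exact ih.tail h2.inv

theorem splits_unique_ran {D E F : TBTDiagram} (hE : ReflTransGen Splits D E)
    (hF : ReflTransGen Splits D F) (h : E.ran = F.ran) : E = F := by
  rw [← inv_inv E, ← inv_inv F, splits_unique (splits_inv hE) (splits_inv hF) h]

/-- `Comp D E F`: the range tree of `D` is the domain tree of `E`, and the diagram `F` is obtained
by gluing `D` and `E` along this tree. -/
inductive Comp : TBTDiagram → TBTDiagram → TBTDiagram → Prop
  | glue (n : ℕ) (R S T : BVTree) (a b : BraidGroup n) (hR : R.numLeaves = n)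
      (hS : S.numLeaves = n) (hT : T.numLeaves = n) :
      Comp ⟨n, R, S, a, hR, hS⟩ ⟨n, S, T, b, hS, hT⟩ ⟨n, R, T, a * b, hR, hT⟩

theorem Comp.ran_eq {D E F : TBTDiagram} (h : Comp D E F) : D.ran = E.dom := by cases h; rfl

theorem exists_comp {D E : TBTDiagram} (h : D.ran = E.dom) : ∃ F, Comp D E F := by
  obtain ⟨n, R, S, a, hR, hS⟩ := D
  obtain ⟨m, S', T, b, hS', hT⟩ := E
  simp only at h
  subst h
  obtain rfl : n = m := hS.symm.trans hS'
  exact ⟨_, .glue n R S T a b hR hS hT⟩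

theorem Comp.unique {D E F F' : TBTDiagram} (h : Comp D E F) (h' : Comp D E F') : F = F' := by
  cases h; cases h'; rfl

theorem Comp.inv {D E F : TBTDiagram} (h : Comp D E F) : Comp E.inv D.inv F.inv := by
  obtain ⟨n, R, S, T, a, b, hR, hS, hT⟩ := h
  simp only [TBTDiagram.inv, mul_inv_rev]
  exact .glue n T S R b⁻¹ a⁻¹ hT hS hR

theorem Comp.step {D E F D' : TBTDiagram} (h : Comp D E F) (h' : Splits D D') :
    ∃ E' F', Splits E E' ∧ Splits F F' ∧ Comp D' E' F' := by
  obtain ⟨i, hi, rfl⟩ := h'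
  obtain ⟨n, R, S, T, a, b, hR, hS, hT⟩ := h
  have hi' : i < n := hi
  refine ⟨_, _, ⟨perm a i, (perm_lt _ _).2 hi', rfl⟩, ⟨i, hi', rfl⟩, ?_⟩
  simp only [split, split_mul, perm_mul]
  apply Comp.glue

theorem Comp.splits {D E F D' : TBTDiagram} (h : Comp D E F) (h' : ReflTransGen Splits D D') :
    ∃ E' F', ReflTransGen Splits E E' ∧ ReflTransGen Splits F F' ∧ Comp D' E' F' := by
  induction h' with
  | refl => exact ⟨_, _, .refl, .refl, h⟩
  | tail _ h2 ih =>
    obtain ⟨E', F', h3, h4, h5⟩ := ih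
    obtain ⟨E'', F'', h6, h7, h8⟩ := h5.step h2
    exact ⟨_, _, h3.tail h6, h4.tail h7, h8⟩

theorem Comp.splits_right {D E F E' : TBTDiagram} (h : Comp D E F)
    (h' : ReflTransGen Splits E E') :
    ∃ D' F', ReflTransGen Splits D D' ∧ ReflTransGen Splits F F' ∧ Comp D' E' F' := by
  obtain ⟨D', F', h1, h2, h3⟩ := h.inv.splits (splits_inv h')
  refine ⟨D'.inv, F'.inv, ?_, ?_, ?_⟩
  · simpa only [inv_inv] using splits_inv h1
  · simpa only [inv_inv] using splits_inv h2
  · simpa only [inv_inv] using h3.inv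

/-- The product of equivalence classes of diagrams is well defined. -/
theorem Comp.congr {D E F D' E' F' : TBTDiagram} (h : Comp D E F) (h' : Comp D' E' F')
    (hD : EqvGen Splits D D') (hE : EqvGen Splits E E') : EqvGen Splits F F' := by
  have up {A B : TBTDiagram} (h : ReflTransGen Splits A B) : EqvGen Splits A B :=
    EqvGen.reflTransGen_le_eqvGen _ _ _ h
  obtain ⟨D2, a1, a2⟩ := join_of_eqvGen hD
  obtain ⟨E1, F1, b1, b2, b3⟩ := h.splits a1
  obtain ⟨E1', F1', c1, c2, c3⟩ := h'.splits a2
  obtain ⟨E2, d1, d2⟩ := join_of_eqvGen (((up b1).symm _ _).trans _ _ _ (hE.trans _ _ _ (up c1)))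
  obtain ⟨D3, F3, e1, e2, e3⟩ := b3.splits_right d1
  obtain ⟨D4, F4, f1, f2, f3⟩ := c3.splits_right d2
  obtain rfl := splits_unique_ran e1 f1 (e3.ran_eq.trans f3.ran_eq.symm)
  obtain rfl := e3.unique f3
  exact (up (b2.trans e2)).trans _ _ _ ((up (c2.trans f2)).symm _ _)

end TBTDiagram

/-- The braided Thompson group: tree-braid-tree diagrams up to the equivalence relation generated
by splittings of strands and reductions of carets. -/
def BV : Type := Quot TBTDiagram.Splits

namespace BV

open Relation TBTDiagram

/-- The element of the group that a diagram represents. -/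
def mk (D : TBTDiagram) : BV := Quot.mk _ D

theorem mk_eq_mk {D E : TBTDiagram} : mk D = mk E ↔ EqvGen Splits D E :=
  ⟨Quot.eqvGen_exact, Quot.eqvGen_sound⟩

theorem mk_splits {D E : TBTDiagram} (h : ReflTransGen Splits D E) : mk D = mk E :=
  mk_eq_mk.2 (EqvGen.reflTransGen_le_eqvGen _ _ _ h)

theorem exists_dom (x : BV) (S : BVTree) : ∃ D, mk D = x ∧ BVTree.Le S D.dom := by
  obtain ⟨D, rfl⟩ := Quot.exists_rep x
  obtain ⟨U, h1, h2⟩ := BVTree.exists_le D.dom S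
  obtain ⟨E, h3, rfl⟩ := D.exists_splits_dom h1
  exact ⟨E, (mk_splits h3).symm, h2⟩

theorem exists_prod (x y : BV) : ∃ D E F, mk D = x ∧ mk E = y ∧ Comp D E F := by
  obtain ⟨D, rfl⟩ := Quot.exists_rep x
  obtain ⟨E, rfl, hE⟩ := exists_dom y D.ran
  obtain ⟨D', h1, h2⟩ := D.inv.exists_splits_dom hE
  obtain ⟨F, hF⟩ := exists_comp (D := D'.inv) (E := E) h2
  refine ⟨_, _, _, (mk_splits ?_).symm, rfl, hF⟩
  simpa only [inv_inv] using splits_inv h1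

/-- The product of two elements: choose representing diagrams `D` and `E` such that the range tree
of `D` is the domain tree of `E`, and glue them. -/
noncomputable instance : Mul BV :=
  ⟨fun x y => mk (exists_prod x y).choose_spec.choose_spec.choose⟩

theorem mk_mul {D E F : TBTDiagram} (h : Comp D E F) : mk D * mk E = mk F := by
  have h' := (exists_prod (mk D) (mk E)).choose_spec.choose_spec.choose_spec
  exact mk_eq_mk.2 (h'.2.2.congr h (mk_eq_mk.1 h'.1) (mk_eq_mk.1 h'.2.1))

/-- The trivial diagram on a tree. -/
def idDiagram (T : BVTree) : TBTDiagram := ⟨T.numLeaves, T, T, 1, rfl, rfl⟩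

instance : One BV := ⟨mk (idDiagram .nil)⟩

theorem mk_id (T : BVTree) : mk (idDiagram T) = 1 := by
  obtain ⟨E, h1, h2⟩ := (idDiagram .nil).exists_splits_dom (S := T) trivial
  have key : ∀ F, ReflTransGen Splits (idDiagram .nil) F → F.ran = F.dom ∧ F.braid = 1 := by
    intro F hF
    induction hF with
    | refl => exact ⟨rfl, rfl⟩
    | tail _ h ih =>
      obtain ⟨i, hi, rfl⟩ := h
      simp only [split, ih.1, ih.2, BraidGroup.split_one, BraidGroup.perm_one, Equiv.Perm.coe_one,
        id_eq]
      exact ⟨trivial, rfl⟩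
  have hE := key E h1
  rw [show (1 : BV) = mk E from mk_splits h1]
  obtain ⟨n, R, S, a, rfl, hS⟩ := E
  obtain rfl : R = T := h2
  obtain rfl : S = R := hE.1
  obtain rfl : a = 1 := hE.2
  rfl

instance : Inv BV :=
  ⟨Quot.map TBTDiagram.inv fun _ _ => Splits.inv⟩

theorem exists_prod₃ (x y z : BV) : ∃ D E F, mk D = x ∧ mk E = y ∧ mk F = z ∧
    D.ran = E.dom ∧ E.ran = F.dom := by
  obtain ⟨D, E, G, rfl, rfl, h⟩ := exists_prod x y
  obtain ⟨F, rfl, hF⟩ := exists_dom z E.ran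
  obtain ⟨E', h1, h2⟩ := E.inv.exists_splits_dom hF
  obtain ⟨D', G', h3, h4, h5⟩ := h.splits_right (E' := E'.inv) (by
    simpa only [inv_inv] using splits_inv h1)
  refine ⟨D', E'.inv, F, (mk_splits h3).symm, (mk_splits ?_).symm, rfl, h5.ran_eq, h2⟩
  simpa only [inv_inv] using splits_inv h1

noncomputable instance : Group BV :=
  Group.ofLeftAxioms
    (by
      intro x y z
      obtain ⟨D, E, F, rfl, rfl, rfl, h1, h2⟩ := exists_prod₃ x y z
      obtain ⟨n, R, S, a, hR, hS⟩ := D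
      obtain ⟨m, S', T, b, hS', hT⟩ := E
      obtain ⟨l, T', U, c, hT', hU⟩ := F
      simp only at h1 h2
      subst h1 h2
      obtain rfl : n = m := hS.symm.trans hS'
      obtain rfl : n = l := hT.symm.trans hT'
      rw [mk_mul (.glue n R S T a b hR hS hT), mk_mul (.glue n S T U b c hS hT hU),
        mk_mul (.glue n R T U (a * b) c hR hT hU), mk_mul (.glue n R S U a (b * c) hR hS hU),
        mul_assoc])
    (by
      intro x
      obtain ⟨D, rfl⟩ := Quot.exists_rep x
      obtain ⟨n, R, S, a, rfl, hS⟩ := D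
      have := mk_mul (.glue _ R R S 1 a rfl rfl hS)
      rw [one_mul] at this
      rw [← mk_id R]
      exact this)
    (by
      intro x
      obtain ⟨D, rfl⟩ := Quot.exists_rep x
      obtain ⟨n, R, S, a, hR, rfl⟩ := D
      have := mk_mul (.glue _ S R S a⁻¹ a rfl hR rfl)
      rw [inv_mul_cancel] at this
      rw [← mk_id S]
      exact this)

/-- The all-right tree with `n` carets. -/
def allRight : ℕ → BVTree
  | 0 => .nil
  | n + 1 => .node () .nil (allRight n)

/-- The generator `x₀`, with the branches `00 → 0`, `01 → 10`, `1 → 11`. -/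
def x₀ : BV :=
  mk ⟨3, .node () (.node () .nil .nil) .nil, allRight 2, 1, rfl, rfl⟩

/-- The generator `x₁`, with the branches `0 → 0`, `100 → 10`, `101 → 110`, `11 → 111`. -/
def x₁ : BV :=
  mk ⟨4, .node () .nil (.node () (.node () .nil .nil) .nil), allRight 3, 1, rfl, rfl⟩

/-- The generator `σ₁`: the first two of three strands cross between all-right trees. -/
def σ₁ : BV := mk ⟨3, allRight 2, allRight 2, BraidGroup.gen 3 0, rfl, rfl⟩

/-- The generator `τ₁`: the two strands between two carets cross. -/
def τ₁ : BV := mk ⟨2, allRight 1, allRight 1, BraidGroup.gen 2 0, rfl, rfl⟩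

/-- The standard generating set. -/
def standardGenerators : Set BV := {x₀, x₁, σ₁, τ₁}

end BV

open scoped NNReal ENNReal

/-- The `δ`-divergence function of the Cayley graph of `G` with respect to `X`. Its value at `x` is
the least `ℓ` such that any two vertices at distance `x` from the identity are connected by a path
of length at most `ℓ` that avoids the ball `{v | d(1, v) < δ x}`; it is `∞` if there is none. -/
noncomputable def divergence {G : Type*} [Group G] (X : Set G) (δ : ℝ) (x : ℝ≥0) : ℝ≥0∞ :=
  ⨆ (g : G) (h : G) (_ : ((SimpleGraph.mulCayley X).dist 1 g : ℝ) = x)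
    (_ : ((SimpleGraph.mulCayley X).dist 1 h : ℝ) = x),
    ⨅ (w : (SimpleGraph.mulCayley X).Walk g h)
      (_ : ∀ v ∈ w.support, δ * x ≤ ((SimpleGraph.mulCayley X).dist 1 v : ℝ)), (w.length : ℝ≥0∞)

/-- The relation `f ≼ g` of asymptotic domination. -/
def AsympDominated (f g : ℝ≥0 → ℝ≥0∞) : Prop :=
  ∃ A B C D E : ℝ≥0, ∀ x : ℝ≥0, f x ≤ A * g (B * x + C) + D * x + E

/-- The relation `f ≈ g` of asymptotic equivalence. -/
def AsympEquivalent (f g : ℝ≥0 → ℝ≥0∞) : Prop := AsympDominated f g ∧ AsympDominated g f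

/-- Linear divergence with respect to a generating set `X`: for some `δ ∈ (0, 1)` the
`δ`-divergence function is equivalent to a linear function. -/
def HasLinearDivergence {G : Type*} [Group G] (X : Set G) : Prop :=
  ∃ δ : ℝ, 0 < δ ∧ δ < 1 ∧ ∃ a : ℝ≥0, 0 < a ∧
    AsympEquivalent (divergence X δ) (fun x => (a : ℝ≥0∞) * x)

/-- The data that determine an asymptotic cone: a non-principal ultrafilter, scaling constants that
tend to infinity along it, and observation points. -/
structure ConeData (V : Type*) where
  /-- The ultrafilter. -/
  ω : Ultrafilter ℕ
  nonprincipal : (ω : Filter ℕ) ≤ Filter.cofinite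
  /-- The scaling constants. -/
  scale : ℕ → ℝ≥0
  scale_pos : ∀ n, 0 < scale n
  scale_tendsto : Filter.Tendsto scale ω Filter.atTop
  /-- The observation points. -/
  base : ℕ → V

namespace ConeData

open Filter Topology

variable {V : Type*} (C : ConeData V) (Γ : SimpleGraph V)

/-- The rescaled distance of the `n`-th terms of two sequences of vertices. -/
noncomputable def scaledDist (x y : ℕ → V) (n : ℕ) : ℝ≥0∞ :=
  (Γ.edist (x n) (y n) : ℝ≥0∞) / C.scale n

/-- The ultralimit of the rescaled distances. -/
noncomputable def limDist (x y : ℕ → V) : ℝ≥0∞ := limUnder (C.ω : Filter ℕ) (C.scaledDist Γ x y)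

theorem tendsto_limDist (x y : ℕ → V) :
    Tendsto (C.scaledDist Γ x y) C.ω (𝓝 (C.limDist Γ x y)) :=
  (C.ω.map (C.scaledDist Γ x y)).le_nhds_lim

/-- The sequences of vertices at finite limit distance from the observation points. -/
def Admissible : Type _ := {x : ℕ → V // C.limDist Γ x C.base ≠ ⊤}

noncomputable instance : PseudoEMetricSpace (C.Admissible Γ) where
  edist x y := C.limDist Γ x.1 y.1
  edist_self x := by
    refine tendsto_nhds_unique (C.tendsto_limDist Γ x.1 x.1) ?_
    have : C.scaledDist Γ x.1 x.1 = fun _ => 0 := by ext n; simp [scaledDist]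
    rw [this]
    exact tendsto_const_nhds
  edist_comm x y := by
    have : C.scaledDist Γ x.1 y.1 = C.scaledDist Γ y.1 x.1 := by
      ext n; rw [scaledDist, scaledDist, SimpleGraph.edist_comm]
    rw [limDist, limDist, this]
  edist_triangle x y z := by
    refine le_of_tendsto_of_tendsto' (C.tendsto_limDist Γ x.1 z.1)
      ((C.tendsto_limDist Γ x.1 y.1).add (C.tendsto_limDist Γ y.1 z.1)) fun n => ?_
    simp only [scaledDist]
    rw [← ENNReal.add_div, ← ENat.toENNReal_add]
    exact ENNReal.div_le_div_right (ENat.toENNReal_le.2 SimpleGraph.edist_triangle) _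

/-- The asymptotic cone of the vertex set of the graph `Γ` with its path metric: admissible
sequences, where sequences at limit distance `0` are identified. -/
abbrev Cone : Type _ := SeparationQuotient (C.Admissible Γ)

end ConeData

/-- A cut-point of a space is a point whose complement is disconnected. -/
def IsCutPoint {Y : Type*} [TopologicalSpace Y] (p : Y) : Prop := ¬ IsPreconnected ({p}ᶜ : Set Y)

/-! The core is `BV.exists_farJoined`: two non-trivial elements of word norm at most R are joined by
a path of length O(R) outside a ball whose radius is about a quarter of the smaller norm. For
elements of equal norm this bounds the divergence linearly with δ = 1/4. Translated and rescaled, it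
yields, for any two points of a cone other than p, a Lipschitz path between them that misses p.

Such paths require lower bounds on norms and commuting elements. The bounds come from an action on
pairs (infinite word, integer), where the integer records the change of prefix length, a logarithmic
slope. A generator changes it by at most 3, so three times the norm bounds any change
(`abs_act_snd_sub_le_wordNorm`). If y lowers the integer by 1 over a fixed word, then for every g
either y or y⁻¹, in the role of y, satisfies |g yⁱ| ≥ i/3 for all i (`exists_ray`). Combined with |g
yⁱ| ≥ |g| - i|y|, this keeps the whole ray at a distance proportional to |g|.

The commuting elements are the copies `rot u` of x₀ below a vertex u. Copies in the two halves of
the tree commute (`rot_commute`). Moving g past a copy below a deep vertex only changes the vertex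
(`rot_addr_append_mul_mk`), because the parallel strands of a split strand are not twisted around
each other. Hence some conjugate of `rot [a]` by g commutes with a copy on the right side of the
tree at depth linear in |g| (`exists_commute_rot`), and that copy is the conjugate of `rot [true]`
by a power of x₀ (`rot_true_cons`), so it is reached in linear length.

In `exists_farJoined_rot_pow` the path first runs along powers of x₀ to gain norm, then reaches a
conjugate c of a power of `rot [a]`. If c commutes with z = f yᵐ f⁻¹, then c z = z c leads from c to
z (`FarJoined.of_commute`). Two applications end at a power of `rot [false]` or of its inverse, and
a detour through `rot [true]` corrects the sign. All elements of norm at most R thus meet at one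
power of `rot [false]`. -/

namespace BraidGroup

/-! ### Doubled strands -/

/-- Parallel strands stay adjacent and in the same order. This allows a doubled strand to be
followed through further splittings. -/
theorem perm_split_self {n : ℕ} (b : BraidGroup n) (i : ℕ) :
    perm (split i b) i = perm b i ∧ perm (split i b) (i + 1) = perm b i + 1 := by
  induction b using gen_induction generalizing i with
  | hg k hk =>
    have p1 := perm_gen (n := n + 1) (k := k) (by omega)
    have p2 := perm_gen (n := n + 1) (k := k + 1) (by omega)
    rw [split_gen _ hk, perm_gen hk, splitGen]
    split_ifs <;> simp only [perm_mul, p1, p2, Equiv.swap_apply_def] <;> grind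
  | h1 => simp
  | hm a b ha hb => simp [split_mul, ha, hb]
  | hi a ha =>
    obtain ⟨i, rfl⟩ := (perm a).surjective i
    rw [split_inv, perm_inv, perm_inv, Equiv.Perm.inv_eq_iff_eq, Equiv.Perm.inv_eq_iff_eq,
      Equiv.Perm.inv_def, Equiv.symm_apply_apply, (ha i).1, (ha i).2]
    exact ⟨rfl, rfl⟩

/-- Splitting either half of a split strand gives the same braid. -/
theorem split_succ_split {n : ℕ} (b : BraidGroup n) (i : ℕ) :
    split (i + 1) (split i b) = split i (split i b) := by
  induction b using gen_induction generalizing i with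
  | hg k hk =>
    have hx : i < k ∨ i = k ∨ i = k + 1 ∨ k + 1 < i := by omega
    rcases hx with h | rfl | rfl | h <;>
      simp (disch := omega) only [split_mul, split_gen_lt, split_gen_left, split_gen_right,
        split_gen_gt, perm_gen_lt, perm_gen_left, perm_gen_right, perm_gen_gt, mul_assoc]
  | h1 => simp
  | hm a b ha hb =>
    rw [split_mul, split_mul, split_mul, (perm_split_self a i).1, (perm_split_self a i).2, ha, hb]
  | hi a ha =>
    obtain ⟨i, rfl⟩ := (perm a).surjective i
    have h := perm_split_self a i
    rw [split_inv, ← h.2, split_inv, ← h.1, split_inv, ha]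

end BraidGroup

/-! ### Growing trees and addresses of leaves -/

namespace BVTree

/-- Every tree arises from the trivial one by attaching carets. -/
theorem attach_induction {P : BVTree → Prop} (h0 : P .nil)
    (h : ∀ T i, i < T.numLeaves → P T → P (attach T i)) (S : BVTree) : P S := by
  have key : ∀ k (T : BVTree), S.numLeaves = T.numLeaves + k → Le T S → P T → P S := by
    intro k
    induction k with
    | zero => intro T hk hT hP; rwa [← hT.numLeaves.2 (by omega)]
    | succ k ih =>
      intro T hk hT hP
      obtain ⟨i, hi, h'⟩ := exists_attach_le hT (by rintro rfl; omega)
      exact ih _ (by rw [numLeaves_attach hi]; omega) h' (h T i hi hP)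
  refine key (S.numLeaves - 1) .nil ?_ trivial h0
  have := S.numLeaves_pos
  simp only [BinaryTree.numLeaves]; omega

/-- The address of the leaf number `i`: the path from the root, where `false` means left. -/
def addr : BVTree → ℕ → List Bool
  | .nil, _ => []
  | .node _ l r, i => if i < l.numLeaves then false :: addr l i else true :: addr r (i - l.numLeaves)

theorem addr_attach {T : BVTree} {i : ℕ} (h : i < T.numLeaves) :
    addr (attach T i) i = addr T i ++ [false] ∧ addr (attach T i) (i + 1) = addr T i ++ [true] := by
  induction T generalizing i with
  | nil =>
    simp only [BinaryTree.numLeaves] at h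
    simp [show i = 0 by omega, attach, addr]
  | node _ l r hl hr =>
    simp only [BinaryTree.numLeaves] at h
    rw [attach]
    split_ifs with h1
    · simp [addr, numLeaves_attach h1, hl h1, h1, show i < l.numLeaves + 1 by omega]
    · have := hr (i := i - l.numLeaves) (by omega)
      simp [addr, h1, show ¬ i + 1 < l.numLeaves by omega, this,
        show i + 1 - l.numLeaves = i - l.numLeaves + 1 by omega]

theorem length_addr_lt {T : BVTree} {i : ℕ} (h : i < T.numLeaves) :
    (addr T i).length < T.numLeaves := by
  induction T generalizing i with
  | nil => simp [addr]
  | node _ l r hl hr =>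
    have := l.numLeaves_pos
    have := r.numLeaves_pos
    simp only [BinaryTree.numLeaves] at h ⊢
    rw [addr]
    split_ifs with h1
    · have := hl h1
      simp only [List.length_cons]; omega
    · have := hr (i := i - l.numLeaves) (by omega)
      simp only [List.length_cons]; omega

/-- A tree with n leaves has depth at most n - 1, so a word of that length descends to a leaf or
below it. -/
theorem exists_addr_append (T : BVTree) {u : List Bool} (h : T.numLeaves ≤ u.length + 1) :
    ∃ i < T.numLeaves, ∃ t, u = addr T i ++ t := by
  induction T generalizing u with
  | nil => exact ⟨0, by simp, u, by simp [addr]⟩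
  | node _ l r hl hr =>
    have := l.numLeaves_pos
    have := r.numLeaves_pos
    simp only [BinaryTree.numLeaves] at h
    match u with
    | [] => simp only [List.length_nil] at h; omega
    | false :: u =>
      simp only [List.length_cons] at h
      obtain ⟨i, hi, t, rfl⟩ := hl (u := u) (by omega)
      refine ⟨i, by simp only [BinaryTree.numLeaves]; omega, t, ?_⟩
      simp [addr, hi]
    | true :: u =>
      simp only [List.length_cons] at h
      obtain ⟨i, hi, t, rfl⟩ := hr (u := u) (by omega)
      refine ⟨i + l.numLeaves, by simp only [BinaryTree.numLeaves]; omega, t, ?_⟩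
      simp [addr]

end BVTree

/-! ### Elements with trivial braid as fractions of trees -/

namespace BV

open Relation BraidGroup BVTree

/-- The element with the trees `A` and `B` and the trivial braid
(with the default value `1` if the numbers of leaves differ). -/
def frac (A B : BVTree) : BV :=
  if h : A.numLeaves = B.numLeaves then mk ⟨B.numLeaves, A, B, 1, h, rfl⟩ else 1

theorem mk_one_eq_frac {n : ℕ} {A B : BVTree} (hA : A.numLeaves = n) (hB : B.numLeaves = n) :
    mk ⟨n, A, B, 1, hA, hB⟩ = frac A B := by
  subst hB; rw [frac, dif_pos hA]

theorem frac_self (A : BVTree) : frac A A = 1 := by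
  rw [← mk_one_eq_frac rfl rfl]; exact mk_id A

theorem frac_mul_frac {A B C : BVTree} (h : A.numLeaves = B.numLeaves)
    (h' : B.numLeaves = C.numLeaves) : frac A B * frac B C = frac A C := by
  rw [← mk_one_eq_frac h rfl, ← mk_one_eq_frac rfl h'.symm, ← mk_one_eq_frac h h'.symm,
    mk_mul (.glue _ A B C 1 1 h rfl h'.symm), one_mul]

theorem mk_split (D : TBTDiagram) {i : ℕ} (hi : i < D.n) : mk (D.split i hi) = mk D :=
  (mk_splits (.single ⟨i, hi, rfl⟩)).symm

theorem mk_eq_mk_split {n : ℕ} {R S : BVTree} {b : BraidGroup n} (hR : R.numLeaves = n)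
    (hS : S.numLeaves = n) {i : ℕ} (hi : i < n) :
    mk ⟨n, R, S, b, hR, hS⟩ = mk ⟨n + 1, R.attach i, S.attach (perm b i), split i b,
      by rw [numLeaves_attach (by omega), hR],
      by rw [numLeaves_attach (by rw [hS, perm_lt]; exact hi), hS]⟩ :=
  (mk_split _ hi).symm

/-- The trivial braid has the identity permutation, so carets at the same leaf number on both sides
cancel. -/
theorem frac_attach {A B : BVTree} (h : A.numLeaves = B.numLeaves) {i : ℕ}
    (hi : i < B.numLeaves) : frac (attach A i) (attach B i) = frac A B := by
  rw [← mk_one_eq_frac h rfl, mk_eq_mk_split _ _ hi]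
  simp only [split_one, perm_one, Equiv.Perm.coe_one, id_eq]
  rw [mk_one_eq_frac]

theorem frac_mul_mk {n : ℕ} {R S T : BVTree} {b : BraidGroup n} (hR : R.numLeaves = n)
    (hS : S.numLeaves = n) (hT : T.numLeaves = n) :
    frac R S * mk ⟨n, S, T, b, hS, hT⟩ = mk ⟨n, R, T, b, hR, hT⟩ := by
  rw [← mk_one_eq_frac hR hS, mk_mul (.glue n R S T 1 b hR hS hT)]
  simp only [one_mul]

theorem mk_mul_frac {n : ℕ} {R S T : BVTree} {b : BraidGroup n} (hR : R.numLeaves = n)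
    (hS : S.numLeaves = n) (hT : T.numLeaves = n) :
    mk ⟨n, R, S, b, hR, hS⟩ * frac S T = mk ⟨n, R, T, b, hR, hT⟩ := by
  rw [← mk_one_eq_frac hS hT, mk_mul (.glue n R S T b 1 hR hS hT)]
  simp only [mul_one]

theorem frac_inv {A B : BVTree} (h : A.numLeaves = B.numLeaves) : (frac A B)⁻¹ = frac B A :=
  inv_eq_of_mul_eq_one_right (by rw [frac_mul_frac h h.symm, frac_self])

/-! ### Generation -/

@[simp] theorem numLeaves_allRight (k : ℕ) : (allRight k).numLeaves = k + 1 := by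
  induction k with
  | zero => rfl
  | succ k ih => simp only [allRight, BinaryTree.numLeaves, ih]; omega

theorem attach_allRight_last (k : ℕ) : attach (allRight k) k = allRight (k + 1) := by
  induction k with
  | zero => rfl
  | succ k ih => simp [allRight, attach, ih]

theorem attach_allRight_zero (k : ℕ) :
    attach (allRight (k + 1)) 0 = .node () (.node () .nil .nil) (allRight k) := by
  simp [allRight, attach]

theorem attach_allRight_succ (k i : ℕ) :
    attach (allRight (k + 1)) (i + 1) = .node () .nil (attach (allRight k) i) := by
  simp [allRight, attach]

/-- Splitting the last strand repeatedly produces representatives of arbitrary size whose range is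
all-right. They can then be composed with larger diagrams. -/
theorem x₀_eq (k : ℕ) : x₀ = frac (attach (allRight (k + 1)) 0) (allRight (k + 2)) := by
  induction k with
  | zero => exact mk_one_eq_frac (A := attach (allRight 1) 0) (B := allRight 2) rfl rfl
  | succ k ih =>
    rw [ih, ← frac_attach (i := k + 2) (by rw [numLeaves_attach] <;> simp) (by simp),
      attach_allRight_last, attach_allRight_zero, attach_allRight_zero]
    congr 1
    simp [attach, attach_allRight_last]

theorem x₁_eq (k : ℕ) : x₁ = frac (attach (allRight (k + 2)) 1) (allRight (k + 3)) := by
  induction k with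
  | zero => exact mk_one_eq_frac (A := attach (allRight 2) 1) (B := allRight 3) rfl rfl
  | succ k ih =>
    rw [ih, ← frac_attach (i := k + 3) (by rw [numLeaves_attach] <;> simp) (by simp),
      attach_allRight_last, attach_allRight_succ, attach_allRight_succ, attach_allRight_zero,
      attach_allRight_zero]
    congr 1
    simp [attach, attach_allRight_last]

/-- The elementary braid number `i` between all-right trees with `k` carets. -/
def crossing (k i : ℕ) : BV :=
  mk ⟨k + 1, allRight k, allRight k, gen (k + 1) i, numLeaves_allRight k, numLeaves_allRight k⟩

theorem mk_congr {n m : ℕ} {R S R' S' : BVTree} {b : BraidGroup n} {c : BraidGroup m}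
    (hn : n = m) (hR : R = R') (hS : S = S') (hb : HEq b c) (h1 : R.numLeaves = n)
    (h2 : S.numLeaves = n) (h3 : R'.numLeaves = m) (h4 : S'.numLeaves = m) :
    mk ⟨n, R, S, b, h1, h2⟩ = mk ⟨m, R', S', c, h3, h4⟩ := by
  subst hn hR hS; rw [eq_of_heq hb]

/-- The last strand takes no part in the crossing and may be split freely. So for each i only two
elements occur: the crossing away from the right end (σ type) and at the right end (τ type). -/
theorem crossing_succ {k i : ℕ} (h : i + 1 < k) : crossing (k + 1) i = crossing k i := by
  symm
  rw [crossing, mk_eq_mk_split (i := k) _ _ (by omega)]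
  refine mk_congr rfl (attach_allRight_last k) ?_ (heq_of_eq ?_) _ _ _ _
  · rw [perm_gen_gt (by omega) h, attach_allRight_last]
  · rw [split_gen_gt (by omega) h]

/-- Strand 0 is idle here. Splitting it shifts the crossing by one position, and x₀ turns the
resulting tree back into an all-right one. -/
theorem inv_x₀_mul_crossing_mul_x₀ {k i : ℕ} (hi : i + 1 ≤ k) :
    x₀⁻¹ * crossing (k + 1) (i + 1) * x₀ = crossing (k + 2) (i + 2) := by
  have hl : (attach (allRight (k + 1)) 0).numLeaves = k + 2 + 1 := by
    rw [numLeaves_attach] <;> simp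
  have h : crossing (k + 1) (i + 1) =
      mk ⟨k + 2 + 1, attach (allRight (k + 1)) 0, attach (allRight (k + 1)) 0,
        gen (k + 3) (i + 2), hl, hl⟩ := by
    rw [crossing, mk_eq_mk_split (i := 0) _ _ (by omega)]
    refine mk_congr rfl rfl ?_ (heq_of_eq ?_) _ _ _ _
    · rw [perm_gen_lt (by omega) (by omega)]
    · rw [split_gen_lt (by omega) (by omega)]
  rw [h, x₀_eq k, frac_inv (by rw [hl]; simp), frac_mul_mk (by simp) hl, mk_mul_frac]
  rfl

/-- Strand 0 now takes part in the crossing, so splitting it gives two elementary crossings, with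
the new caret moving from leaf 0 to leaf 1. This relation replaces the conjugation by x₀, which
cannot produce position 1 from position 0. -/
theorem crossing_zero_eq (k : ℕ) : crossing (k + 1) 0 =
    x₀ * crossing (k + 2) 1 * crossing (k + 2) 0 * frac (allRight (k + 2))
      (attach (allRight (k + 1)) 1) := by
  have hl (i) (hi : i < k + 2) : (attach (allRight (k + 1)) i).numLeaves = k + 2 + 1 := by
    rw [numLeaves_attach] <;> simp [hi]
  have h : crossing (k + 1) 0 =
      mk ⟨k + 2 + 1, attach (allRight (k + 1)) 0, attach (allRight (k + 1)) 1,
        gen (k + 3) 1 * gen (k + 3) 0, hl 0 (by omega), hl 1 (by omega)⟩ := by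
    rw [crossing, mk_eq_mk_split (i := 0) _ _ (by omega)]
    refine mk_congr rfl rfl ?_ (heq_of_eq ?_) _ _ _ _
    · rw [perm_gen_left (by omega)]
    · rw [split_gen_left (by omega)]
  rw [h, x₀_eq k, mul_assoc (frac _ _), crossing, crossing,
    mk_mul (.glue _ _ _ _ _ _ _ _ _), frac_mul_mk (hl 0 (by omega)), mk_mul_frac]

theorem τ₁_eq : τ₁ = x₀ * crossing 2 1 * σ₁ := by
  have := crossing_zero_eq 0
  rw [attach_allRight_last 1, frac_self, mul_one] at this
  exact this

theorem σ₁_eq : σ₁ = x₀ * crossing 3 1 * σ₁ * x₁⁻¹ := by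
  have := crossing_zero_eq 1
  rw [x₁_eq 0, frac_inv (by rw [numLeaves_attach] <;> simp)]
  rw [crossing_succ (k := 2) (i := 0) (by omega)] at this
  exact this

theorem x₀_mem : x₀ ∈ Subgroup.closure standardGenerators :=
  Subgroup.subset_closure (by simp [standardGenerators])

theorem x₁_mem : x₁ ∈ Subgroup.closure standardGenerators :=
  Subgroup.subset_closure (by simp [standardGenerators])

theorem σ₁_mem : σ₁ ∈ Subgroup.closure standardGenerators :=
  Subgroup.subset_closure (by simp [standardGenerators])

theorem τ₁_mem : τ₁ ∈ Subgroup.closure standardGenerators :=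
  Subgroup.subset_closure (by simp [standardGenerators])

theorem conj_x₀_mem {g : BV} (h : g ∈ Subgroup.closure standardGenerators) :
    x₀⁻¹ * g * x₀ ∈ Subgroup.closure standardGenerators :=
  mul_mem (mul_mem (inv_mem x₀_mem) h) x₀_mem

/-- These fractions are the standard generators of Thompson's group F: x₀ and x₁ are given, and
conjugation by x₀ raises a positive index by one. -/
theorem frac_attach_allRight_mem {k i : ℕ} (hi : i ≤ k) :
    frac (attach (allRight k) i) (allRight (k + 1)) ∈ Subgroup.closure standardGenerators := by
  induction i generalizing k with
  | zero =>
    cases k with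
    | zero => rw [attach_allRight_last, frac_self]; exact one_mem _
    | succ k => rw [← x₀_eq]; exact x₀_mem
  | succ i ih =>
    match k, i with
    | 0, _ => omega
    | 1, i =>
      obtain rfl : i = 0 := by omega
      rw [attach_allRight_last, frac_self]; exact one_mem _
    | k + 2, 0 => rw [← x₁_eq]; exact x₁_mem
    | k + 2, i + 1 =>
      have h := conj_x₀_mem (ih (k := k + 1) (by omega))
      convert h using 1
      have hl (i) (hi : i < k + 2) : (attach (allRight (k + 1)) i).numLeaves = k + 3 := by
        rw [numLeaves_attach] <;> simp [hi]
      have hl' (i) (hi : i < k + 3) : (attach (allRight (k + 2)) i).numLeaves = k + 4 := by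
        rw [numLeaves_attach] <;> simp [hi]
      have hl'' : (attach (attach (allRight (k + 1)) 0) (i + 2)).numLeaves = k + 4 := by
        rw [numLeaves_attach] <;> simp [hl 0 (by omega)]; omega
      -- Both factors are refined, by a caret at leaf 0 and by one at leaf `i + 2`, so that the
      -- three fractions telescope.
      have e : frac (attach (allRight (k + 1)) (i + 1)) (allRight (k + 2)) =
          frac (attach (attach (allRight (k + 1)) 0) (i + 2)) (attach (allRight (k + 2)) 0) := by
        rw [attach_attach (i := 0) (j := i + 1) (by simp) (by simp; omega) (by omega),
          frac_attach]
        · rw [hl _ (by omega), numLeaves_allRight]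
        · simp
      have e' : x₀⁻¹ = frac (attach (allRight (k + 2)) (i + 2))
          (attach (attach (allRight (k + 1)) 0) (i + 2)) := by
        rw [frac_attach, x₀_eq k, frac_inv]
        · rw [hl _ (by omega), numLeaves_allRight]
        · rw [hl _ (by omega), numLeaves_allRight]
        · rw [hl _ (by omega)]; omega
      rw [e, e', x₀_eq (k + 1), frac_mul_frac, frac_mul_frac]
      all_goals simp [hl'', hl' (i + 2) (by omega), hl' 0 (by omega)]

/-- Building the tree caret by caret multiplies the fraction by one of the elements from
`frac_attach_allRight_mem` at each stage. -/
theorem frac_allRight_mem (T : BVTree) :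
    frac T (allRight (T.numLeaves - 1)) ∈ Subgroup.closure standardGenerators := by
  induction T using attach_induction with
  | h0 => simp [allRight, frac_self]
  | h T i hi ih =>
    have h : T.numLeaves = T.numLeaves - 1 + 1 := by omega
    generalize T.numLeaves - 1 = k at *
    rw [h] at hi
    rw [numLeaves_attach (by omega), h, Nat.add_sub_cancel]
    have hl : (attach (allRight k) i).numLeaves = k + 2 := by
      rw [numLeaves_attach] <;> simp [hi]
    rw [← frac_mul_frac (B := attach (allRight k) i)]
    · refine mul_mem ?_ (frac_attach_allRight_mem (by omega))
      rwa [frac_attach]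
      · simp [h]
      · simpa using hi
    · rw [numLeaves_attach (by omega), hl, h]
    · simp [hl]

theorem crossing_mem {k i : ℕ} (h : i < k) :
    crossing k i ∈ Subgroup.closure standardGenerators := by
  -- It suffices to treat both types of crossing at each position. Position 1 is obtained by solving
  -- `σ₁_eq` and `τ₁_eq`; later positions follow by conjugation with x₀.
  have h0 : ∀ i, crossing (i + 2) i ∈ Subgroup.closure standardGenerators ∧
      crossing (i + 1) i ∈ Subgroup.closure standardGenerators := by
    intro i
    induction i with
    | zero => exact ⟨σ₁_mem, τ₁_mem⟩
    | succ i ih =>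
      cases i with
      | zero =>
        constructor
        · have : crossing 3 1 = x₀⁻¹ * σ₁ * x₁ * σ₁⁻¹ := by
            have h : σ₁ * x₁ = x₀ * crossing 3 1 * σ₁ := eq_mul_inv_iff_mul_eq.1 σ₁_eq
            rw [mul_assoc x₀⁻¹, h]; group
          rw [this]
          exact mul_mem (mul_mem (mul_mem (inv_mem x₀_mem) σ₁_mem) x₁_mem) (inv_mem σ₁_mem)
        · have : crossing 2 1 = x₀⁻¹ * τ₁ * σ₁⁻¹ := by
            rw [τ₁_eq]; group
          rw [this]
          exact mul_mem (mul_mem (inv_mem x₀_mem) τ₁_mem) (inv_mem σ₁_mem)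
      | succ i =>
        rw [← inv_x₀_mul_crossing_mul_x₀ (by omega), ← inv_x₀_mul_crossing_mul_x₀ (by omega)]
        exact ⟨conj_x₀_mem ih.1, conj_x₀_mem ih.2⟩
  induction k with
  | zero => omega
  | succ k ih =>
    by_cases h1 : i + 1 < k
    · rw [crossing_succ h1]; exact ih (by omega)
    · by_cases h2 : i = k
      · subst h2; exact (h0 i).2
      · obtain rfl : k = i + 1 := by omega
        exact (h0 i).1

theorem mk_allRight_mem {k : ℕ} (b : BraidGroup (k + 1)) :
    mk ⟨k + 1, allRight k, allRight k, b, numLeaves_allRight k, numLeaves_allRight k⟩ ∈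
      Subgroup.closure standardGenerators := by
  induction b using gen_induction with
  | hg i hi => exact crossing_mem (by omega)
  | h1 => rw [mk_one_eq_frac, frac_self]; exact one_mem _
  | hm a b ha hb =>
    rw [← mk_mul (.glue _ _ (allRight k) _ _ _ _ (numLeaves_allRight k) _)]
    exact mul_mem ha hb
  | hi a ha =>
    have := mk_mul (.glue _ _ (allRight k) _ a a⁻¹ (numLeaves_allRight k) (numLeaves_allRight k)
      (numLeaves_allRight k))
    simp only [mul_inv_cancel] at this
    rw [mk_one_eq_frac, frac_self] at this
    rw [← inv_eq_of_mul_eq_one_right this]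
    exact inv_mem ha

/-- A diagram factors into a fraction ending in an all-right tree, a braid between all-right trees,
and the inverse of such a fraction. -/
theorem closure_standardGenerators : Subgroup.closure standardGenerators = ⊤ := by
  refine eq_top_iff.2 fun x _ => ?_
  obtain ⟨⟨n, R, S, b, hR, hS⟩, rfl⟩ := Quot.exists_rep x
  change mk _ ∈ _
  obtain ⟨k, rfl⟩ : ∃ k, n = k + 1 := ⟨n - 1, by have := R.numLeaves_pos; omega⟩
  have h1 := frac_allRight_mem R
  have h2 := frac_allRight_mem S
  rw [hR, Nat.add_sub_cancel] at h1
  rw [hS, Nat.add_sub_cancel] at h2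
  rw [← frac_mul_mk hR (numLeaves_allRight k) hS, ← mk_mul_frac (numLeaves_allRight k)
    (numLeaves_allRight k) hS, ← frac_inv (A := S) (by simp [hS])]
  exact mul_mem h1 (mul_mem (mk_allRight_mem b) (inv_mem h2))

end BV

namespace BV

open Relation BraidGroup BVTree

/-! ### Copies of `x₀` below a vertex -/

/-- Equal fractions have a common refinement, and every refinement of a trivial braid is trivial. An
operation `f` that grafts the tree into a larger one turns each splitting into a splitting with
shifted leaf number, so it respects equality of fractions. -/
theorem frac_congr_of_splits {f : BVTree → BVTree} {c : ℕ}
    (hf : ∀ T i, i < T.numLeaves → f (attach T i) = attach (f T) (i + c))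
    (hc : ∀ T, T.numLeaves + c ≤ (f T).numLeaves)
    (hl : ∀ S T, S.numLeaves = T.numLeaves → (f S).numLeaves = (f T).numLeaves)
    {A B A' B' : BVTree} (hA : A.numLeaves = B.numLeaves) (hA' : A'.numLeaves = B'.numLeaves)
    (h : frac A B = frac A' B') : frac (f A) (f B) = frac (f A') (f B') := by
  have key : ∀ {A B : BVTree} (hA : A.numLeaves = B.numLeaves) (K : TBTDiagram),
      ReflTransGen TBTDiagram.Splits ⟨_, A, B, 1, hA, rfl⟩ K →
        K.braid = 1 ∧ frac (f A) (f B) = frac (f K.dom) (f K.ran) := by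
    intro A B hA K hK
    induction hK with
    | refl => exact ⟨rfl, rfl⟩
    | @tail K _ _ h ih =>
      obtain ⟨i, hi, rfl⟩ := h
      have h1 := K.dom_leaves
      have h2 := K.ran_leaves
      have := hc K.ran
      refine ⟨by simp only [TBTDiagram.split, ih.1, split_one]; rfl, ?_⟩
      simp only [TBTDiagram.split, ih.1, perm_one, Equiv.Perm.coe_one, id_eq]
      rw [ih.2, hf _ _ (by omega), hf _ _ (by omega), frac_attach (hl _ _ (by omega)) (by omega)]
  rw [← mk_one_eq_frac hA rfl, ← mk_one_eq_frac hA' rfl] at h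
  obtain ⟨K, h1, h2⟩ := TBTDiagram.join_of_eqvGen (mk_eq_mk.1 h)
  rw [(key hA K h1).2, (key hA' K h2).2]

theorem frac_node_left_congr {A B A' B' : BVTree} (hA : A.numLeaves = B.numLeaves)
    (hA' : A'.numLeaves = B'.numLeaves) (h : frac A B = frac A' B') (C : BVTree) :
    frac (.node () A C) (.node () B C) = frac (.node () A' C) (.node () B' C) :=
  frac_congr_of_splits (f := fun T => .node () T C) (c := 0)
    (fun T i hi => by simp [attach, hi]) (fun T => by simp)
    (fun S T h => by simp [h]) hA hA' h

theorem frac_node_right_congr {A B A' B' : BVTree} (hA : A.numLeaves = B.numLeaves)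
    (hA' : A'.numLeaves = B'.numLeaves) (h : frac A B = frac A' B') (C : BVTree) :
    frac (.node () C A) (.node () C B) = frac (.node () C A') (.node () C B') :=
  frac_congr_of_splits (f := fun T => .node () C T) (c := C.numLeaves)
    (fun T i hi => by simp [attach]) (fun T => by simp [add_comm])
    (fun S T h => by simp [h]) hA hA' h

/-- The half `C` is the same on both sides, so its carets reduce away. -/
theorem frac_node_left {A B : BVTree} (h : A.numLeaves = B.numLeaves) (C : BVTree) :
    frac (.node () A C) (.node () B C) = frac (.node () A .nil) (.node () B .nil) := by
  induction C using attach_induction with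
  | h0 => rfl
  | h C i hi ih =>
    have e (A : BVTree) : BinaryTree.node () A (attach C i) =
        attach (.node () A C) (i + A.numLeaves) := by simp [attach]
    rw [e, e, h, frac_attach, ih] <;> simp [h]; omega

theorem frac_node_right {A B : BVTree} (h : A.numLeaves = B.numLeaves) (C : BVTree) :
    frac (.node () C A) (.node () C B) = frac (.node () .nil A) (.node () .nil B) := by
  induction C using attach_induction with
  | h0 => rfl
  | h C i hi ih =>
    have e (A : BVTree) : BinaryTree.node () (attach C i) A =
        attach (.node () C A) i := by simp [attach, hi]
    rw [e, e, frac_attach, ih] <;> simp [h]; omega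

/-- The smallest tree that contains the caret below the vertex `u` and the caret below its left
child. -/
def leftTree : List Bool → BVTree
  | [] => .node () (.node () .nil .nil) .nil
  | false :: u => .node () (leftTree u) .nil
  | true :: u => .node () .nil (leftTree u)

/-- The smallest tree that contains the caret below the vertex `u` and the caret below its right
child. -/
def rightTree : List Bool → BVTree
  | [] => .node () .nil (.node () .nil .nil)
  | false :: u => .node () (rightTree u) .nil
  | true :: u => .node () .nil (rightTree u)

theorem numLeaves_leftTree (u : List Bool) : (leftTree u).numLeaves = (rightTree u).numLeaves := by
  induction u with
  | nil => rfl
  | cons a u ih => cases a <;> simp [leftTree, rightTree, ih]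

/-- The copy of `x₀` that acts below the vertex `u`. -/
def rot (u : List Bool) : BV := frac (leftTree u) (rightTree u)

theorem frac_attach_attach {T : BVTree} {i : ℕ} (h : i < T.numLeaves) :
    frac (attach (attach T i) i) (attach (attach T i) (i + 1)) = rot (addr T i) := by
  induction T generalizing i with
  | nil =>
    simp only [BinaryTree.numLeaves] at h
    obtain rfl : i = 0 := by omega
    rfl
  | node _ l r hl hr =>
    simp only [BinaryTree.numLeaves] at h
    by_cases h1 : i < l.numLeaves
    · have e := hl h1
      have h2 := numLeaves_attach h1
      have h3 := numLeaves_attach (T := attach l i) (i := i) (by omega)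
      have h4 := numLeaves_attach (T := attach l i) (i := i + 1) (by omega)
      simp only [attach, addr, h1, if_true, h2, show i < l.numLeaves + 1 by omega,
        show i + 1 < l.numLeaves + 1 by omega]
      rw [frac_node_left (by omega),
        frac_node_left_congr (by omega) (numLeaves_leftTree (addr l i)) e]
      rfl
    · have h0 : i - l.numLeaves < r.numLeaves := by omega
      have e := hr h0
      have h2 := numLeaves_attach h0
      have h3 := numLeaves_attach (T := attach r (i - l.numLeaves)) (i := i - l.numLeaves) (by omega)
      have h4 := numLeaves_attach (T := attach r (i - l.numLeaves)) (i := i - l.numLeaves + 1)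
        (by omega)
      simp only [attach, addr, h1, if_false, show ¬ i + 1 < l.numLeaves by omega,
        show i + 1 - l.numLeaves = i - l.numLeaves + 1 by omega]
      rw [frac_node_right (by omega),
        frac_node_right_congr (by omega) (numLeaves_leftTree (addr r (i - l.numLeaves))) e]
      rfl

/-- Both products equal the fraction that performs the two rotations side by side. -/
theorem rot_commute (u v : List Bool) : Commute (rot (false :: u)) (rot (true :: v)) := by
  have hu := numLeaves_leftTree u
  have hv := numLeaves_leftTree v
  have e1 (C) : rot (false :: u) = frac (.node () (leftTree u) C) (.node () (rightTree u) C) :=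
    (frac_node_left hu C).symm
  have e2 (C) : rot (true :: v) = frac (.node () C (leftTree v)) (.node () C (rightTree v)) :=
    (frac_node_right hv C).symm
  have h1 : rot (false :: u) * rot (true :: v) = frac (.node () (leftTree u) (leftTree v))
      (.node () (rightTree u) (rightTree v)) := by
    rw [e1 (leftTree v), e2 (rightTree u), frac_mul_frac] <;> simp [hu, hv]
  have h2 : rot (true :: v) * rot (false :: u) = frac (.node () (leftTree u) (leftTree v))
      (.node () (rightTree u) (rightTree v)) := by
    rw [e1 (rightTree v), e2 (leftTree u), frac_mul_frac] <;> simp [hu, hv]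
  exact h1.trans h2.symm

/-- Tripling the strand at `i` can be done by splitting its left or its right half, with the same
braid (`split_succ_split`). Passing from one form to the other multiplies by a rotation at either
end of the strand. -/
theorem rot_addr_mul_mk {n : ℕ} {R S : BVTree} {b : BraidGroup n} (hR : R.numLeaves = n)
    (hS : S.numLeaves = n) {i : ℕ} (hi : i < n) :
    rot (addr R i) * mk ⟨n, R, S, b, hR, hS⟩ =
      mk ⟨n, R, S, b, hR, hS⟩ * rot (addr S (perm b i)) := by
  have hj : perm b i < n := (perm_lt b i).2 hi
  have hp := perm_split_self b i
  have hl (T : BVTree) (k l) (hT : T.numLeaves = n) (hk : k < n) (hl : l < n + 1) :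
      (attach (attach T k) l).numLeaves = n + 1 + 1 := by
    rw [numLeaves_attach, numLeaves_attach, hT] <;> try rw [numLeaves_attach]
    all_goals omega
  have e1 : mk ⟨n, R, S, b, hR, hS⟩ = mk ⟨n + 1 + 1, attach (attach R i) i,
      attach (attach S (perm b i)) (perm b i), split i (split i b),
      hl _ _ _ hR hi (by omega), hl _ _ _ hS hj (by omega)⟩ := by
    rw [mk_eq_mk_split hR hS hi, mk_eq_mk_split (i := i) _ _ (by omega)]
    exact mk_congr rfl rfl (by rw [hp.1]) HEq.rfl _ _ _ _
  have e2 : mk ⟨n, R, S, b, hR, hS⟩ = mk ⟨n + 1 + 1, attach (attach R i) (i + 1),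
      attach (attach S (perm b i)) (perm b i + 1), split i (split i b),
      hl _ _ _ hR hi (by omega), hl _ _ _ hS hj (by omega)⟩ := by
    rw [mk_eq_mk_split hR hS hi, mk_eq_mk_split (i := i + 1) _ _ (by omega)]
    exact mk_congr rfl rfl (by rw [hp.2]) (heq_of_eq (split_succ_split b i)) _ _ _ _
  conv_lhs => rw [e2]
  conv_rhs => rw [e1]
  rw [← frac_attach_attach (by omega), ← frac_attach_attach (by omega), frac_mul_mk, mk_mul_frac]

/-- Splitting the strand along the letters of `t` moves the vertex up to a leaf, which reduces to
the case of an empty `t`. -/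
theorem rot_addr_append_mul_mk (t : List Bool) {n : ℕ} {R S : BVTree} {b : BraidGroup n}
    (hR : R.numLeaves = n) (hS : S.numLeaves = n) {i : ℕ} (hi : i < n) :
    rot (addr R i ++ t) * mk ⟨n, R, S, b, hR, hS⟩ =
      mk ⟨n, R, S, b, hR, hS⟩ * rot (addr S (perm b i) ++ t) := by
  induction t generalizing n R S b i with
  | nil => simpa using rot_addr_mul_mk hR hS hi
  | cons a t ih =>
    have hj : perm b i < n := (perm_lt b i).2 hi
    have hp := perm_split_self b i
    have hR' := addr_attach (T := R) (i := i) (by omega)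
    have hS' := addr_attach (T := S) (i := perm b i) (by omega)
    rw [mk_eq_mk_split hR hS hi]
    cases a with
    | false =>
      have := ih (R := attach R i) (S := attach S (perm b i)) (b := split i b) (i := i)
        (by rw [numLeaves_attach] <;> omega) (by rw [numLeaves_attach] <;> omega) (by omega)
      simpa only [hp, hR', hS', List.append_assoc, List.singleton_append] using this
    | true =>
      have := ih (R := attach R i) (S := attach S (perm b i)) (b := split i b) (i := i + 1)
        (by rw [numLeaves_attach] <;> omega) (by rw [numLeaves_attach] <;> omega) (by omega)
      simpa only [hp, hR', hS', List.append_assoc, List.singleton_append] using this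

/-- With at most 4 leaves every leaf has depth at most 3. Hence a word of length 3 reaches a leaf,
and replacing the address costs at most 3 letters. -/
theorem exists_rot_mul_mk {D : TBTDiagram} (hD : D.n ≤ 4) {u : List Bool} (hu : 3 ≤ u.length) :
    ∃ v, u.length ≤ v.length + 3 ∧ rot u * mk D = mk D * rot v := by
  obtain ⟨n, R, S, b, hR, hS⟩ := D
  simp only at hD
  obtain ⟨i, hi, t, rfl⟩ := exists_addr_append R (u := u) (by omega)
  refine ⟨addr S (perm b i) ++ t, ?_, rot_addr_append_mul_mk t hR hS (by omega)⟩
  have := length_addr_lt hi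
  simp only [List.length_append]
  omega

theorem exists_mk_of_mem {s : BV} (hs : s ∈ standardGenerators) :
    ∃ D : TBTDiagram, mk D = s ∧ D.n ≤ 4 := by
  rcases hs with rfl | rfl | rfl | rfl <;> exact ⟨_, rfl, by norm_num⟩

theorem mk_inv (D : TBTDiagram) : (mk D)⁻¹ = mk D.inv := rfl

theorem exists_mk_of_adj {a b : BV} (h : (SimpleGraph.mulCayley standardGenerators).Adj a b) :
    ∃ D : TBTDiagram, a * mk D = b ∧ D.n ≤ 4 := by
  rw [SimpleGraph.mulCayley_adj] at h
  rcases h.2 with h | h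
  · obtain ⟨D, h1, h2⟩ := exists_mk_of_mem h
    exact ⟨D, by rw [h1]; group, h2⟩
  · obtain ⟨D, h1, h2⟩ := exists_mk_of_mem h
    exact ⟨D.inv, by rw [← mk_inv, h1]; group, h2⟩

theorem exists_rot_mul {a b : BV} (w : (SimpleGraph.mulCayley standardGenerators).Walk a b)
    {u : List Bool} (hu : 3 * w.length + 3 ≤ u.length) :
    ∃ v, u.length ≤ v.length + 3 * w.length ∧ rot u * (a⁻¹ * b) = a⁻¹ * b * rot v := by
  induction w generalizing u with
  | nil => exact ⟨u, by simp, by simp⟩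
  | @cons a c b h p ih =>
    simp only [SimpleGraph.Walk.length_cons] at hu ⊢
    obtain ⟨D, rfl, hD⟩ := exists_mk_of_adj h
    obtain ⟨v, hv, e⟩ := exists_rot_mul_mk hD (u := u) (by omega)
    obtain ⟨v', hv', e'⟩ := ih (u := v) (by omega)
    refine ⟨v', by omega, ?_⟩
    have : a⁻¹ * b = mk D * ((a * mk D)⁻¹ * b) := by group
    rw [this, ← mul_assoc, e, mul_assoc, e', ← mul_assoc]

/-- x₀ has the branch 1 → 11, so conjugation by it pushes a copy one step down the right side. This
keeps the word norm of a deep copy linear in its depth. -/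
theorem rot_true_cons (k : ℕ) :
    rot (List.replicate (k + 1) true) = (x₀ ^ k)⁻¹ * rot [true] * x₀ ^ k := by
  induction k with
  | zero => simp
  | succ k ih =>
    have h : rot (List.replicate (k + 1) true) * x₀ = x₀ * rot (List.replicate (k + 2) true) := by
      have := rot_addr_append_mul_mk (List.replicate k true)
        (R := .node () (.node () .nil .nil) .nil) (S := allRight 2) (b := (1 : BraidGroup 3))
        (i := 2) rfl rfl (by omega)
      rw [perm_one] at this
      exact this
    rw [eq_inv_mul_of_mul_eq h.symm, ih, pow_succ]
    group

end BV

/-! ### The action on infinite words with an integer -/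

/-- Prepend a letter to an infinite word. -/
def seqCons (a : Bool) (ξ : ℕ → Bool) : ℕ → Bool
  | 0 => a
  | k + 1 => ξ k

theorem seqCons_zero_shift (ξ : ℕ → Bool) : seqCons (ξ 0) (fun k => ξ (k + 1)) = ξ := by
  funext k; cases k <;> rfl

namespace BVTree

open BraidGroup (up)

/-- The parametrization of pairs (infinite word, integer) by the leaves of a tree: the address of
the leaf is put in front of the word, and its length is added to the integer. -/
def insertAddr : BVTree → ℕ → (ℕ → Bool) × ℤ → (ℕ → Bool) × ℤ
  | .nil, _, x => x
  | .node _ l r, i, x =>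
    if i < l.numLeaves then
      (seqCons false (insertAddr l i x).1, (insertAddr l i x).2 + 1)
    else
      (seqCons true (insertAddr r (i - l.numLeaves) x).1,
        (insertAddr r (i - l.numLeaves) x).2 + 1)

/-- The leaf of the tree at which an infinite word arrives, and what is left of the word. -/
def removeAddr : BVTree → (ℕ → Bool) × ℤ → ℕ × ((ℕ → Bool) × ℤ)
  | .nil, x => (0, x)
  | .node _ l r, x =>
    if x.1 0 then
      ((removeAddr r (fun k => x.1 (k + 1), x.2 - 1)).1 + l.numLeaves,
        (removeAddr r (fun k => x.1 (k + 1), x.2 - 1)).2)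
    else removeAddr l (fun k => x.1 (k + 1), x.2 - 1)

theorem removeAddr_lt (T : BVTree) (x : (ℕ → Bool) × ℤ) : (removeAddr T x).1 < T.numLeaves := by
  induction T generalizing x with
  | nil => simp [removeAddr]
  | node _ l r hl hr =>
    rw [removeAddr, BinaryTree.numLeaves]
    split_ifs
    · have := hr (fun k => x.1 (k + 1), x.2 - 1)
      simp only; omega
    · have := hl (fun k => x.1 (k + 1), x.2 - 1)
      omega

theorem insertAddr_removeAddr (T : BVTree) (x : (ℕ → Bool) × ℤ) :
    insertAddr T (removeAddr T x).1 (removeAddr T x).2 = x := by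
  induction T generalizing x with
  | nil => rfl
  | node _ l r hl hr =>
    have hx := seqCons_zero_shift x.1
    rw [removeAddr]
    split_ifs with h
    · rw [h] at hx
      simp [insertAddr, hr, hx]
    · have h' : x.1 0 = false := by simpa using h
      rw [h'] at hx
      simp [insertAddr, hl, removeAddr_lt, hx]

theorem removeAddr_insertAddr {T : BVTree} {i : ℕ} (h : i < T.numLeaves) (x : (ℕ → Bool) × ℤ) :
    removeAddr T (insertAddr T i x) = (i, x) := by
  induction T generalizing i x with
  | nil => simp only [BinaryTree.numLeaves] at h; rw [removeAddr, insertAddr, show i = 0 by omega]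
  | node _ l r hl hr =>
    simp only [BinaryTree.numLeaves] at h
    rw [insertAddr]
    split_ifs with h1
    · simp [removeAddr, seqCons, hl h1]
    · simp [removeAddr, seqCons, hr (i := i - l.numLeaves) (by omega), Nat.sub_add_cancel (not_lt.1 h1)]

theorem insertAddr_attach_up {T : BVTree} {i j : ℕ} (hi : i < T.numLeaves) (hj : j < T.numLeaves)
    (hij : i ≠ j) (x : (ℕ → Bool) × ℤ) :
    insertAddr (attach T i) (up i j) x = insertAddr T j x := by
  induction T generalizing i j with
  | nil => simp only [BinaryTree.numLeaves] at hi hj; omega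
  | node _ l r hl hr =>
    simp only [BinaryTree.numLeaves] at hi hj
    rw [attach]
    by_cases h1 : i < l.numLeaves
    · rw [if_pos h1]
      by_cases h2 : j < l.numLeaves
      · have h3 : up i j < l.numLeaves + 1 := up_lt h2
        simp [insertAddr, numLeaves_attach h1, h2, h3, hl h1 h2 hij]
      · have h3 : up i j = j + 1 := by rw [up, if_neg (by omega)]
        simp [insertAddr, numLeaves_attach h1, h2, h3]
    · rw [if_neg h1]
      by_cases h2 : j < l.numLeaves
      · have h3 : up i j = j := by rw [up, if_pos (by omega)]
        simp [insertAddr, h2, h3]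
      · have h3 : ¬ up i j < l.numLeaves := by rw [up]; split_ifs <;> omega
        have h4 : up i j - l.numLeaves = up (i - l.numLeaves) (j - l.numLeaves) := by
          unfold up; split_ifs <;> omega
        simp [insertAddr, h2, h3, h4, hr (i := i - l.numLeaves) (j := j - l.numLeaves) (by omega)
          (by omega) (by omega)]

theorem insertAddr_attach_self {T : BVTree} {i : ℕ} (hi : i < T.numLeaves) (ξ : ℕ → Bool) (k : ℤ) :
    insertAddr (attach T i) i (ξ, k) = insertAddr T i (seqCons false ξ, k + 1) ∧
    insertAddr (attach T i) (i + 1) (ξ, k) = insertAddr T i (seqCons true ξ, k + 1) := by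
  induction T generalizing i with
  | nil =>
    simp only [BinaryTree.numLeaves] at hi
    simp [show i = 0 by omega, attach, insertAddr]
  | node _ l r hl hr =>
    simp only [BinaryTree.numLeaves] at hi
    rw [attach]
    by_cases h1 : i < l.numLeaves
    · simp [h1, insertAddr, numLeaves_attach, hl h1, show i < l.numLeaves + 1 by omega]
    · simp [h1, insertAddr, show ¬ i + 1 < l.numLeaves by omega,
        show i + 1 - l.numLeaves = i - l.numLeaves + 1 by omega,
        hr (i := i - l.numLeaves) (by omega)]

/-- The integer grows by the depth of the leaf, which is smaller than the number of leaves. -/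
theorem insertAddr_snd {T : BVTree} {i : ℕ} (hi : i < T.numLeaves) (x : (ℕ → Bool) × ℤ) :
    x.2 ≤ (insertAddr T i x).2 ∧ (insertAddr T i x).2 < x.2 + T.numLeaves := by
  induction T generalizing i with
  | nil => simp [insertAddr]
  | node _ l r hl hr =>
    simp only [BinaryTree.numLeaves] at hi
    have := l.numLeaves_pos
    have := r.numLeaves_pos
    rw [insertAddr, BinaryTree.numLeaves]
    split_ifs with h1
    · have := hl h1
      simp only; push_cast; omega
    · have := hr (i := i - l.numLeaves) (by omega)
      simp only; push_cast; omega

end BVTree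

namespace TBTDiagram

open Relation BraidGroup BVTree

/-- The action of a diagram on pairs (infinite word, integer): the address of a leaf of the domain
tree is replaced by the address of the corresponding leaf of the range tree, and the integer
changes by the difference of the lengths. -/
def act (D : TBTDiagram) (x : (ℕ → Bool) × ℤ) : (ℕ → Bool) × ℤ :=
  insertAddr D.ran (perm D.braid (removeAddr D.dom x).1) (removeAddr D.dom x).2

theorem act_insertAddr (D : TBTDiagram) {i : ℕ} (hi : i < D.n) (x : (ℕ → Bool) × ℤ) :
    D.act (insertAddr D.dom i x) = insertAddr D.ran (perm D.braid i) x := by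
  rw [act, removeAddr_insertAddr (by rwa [D.dom_leaves])]

theorem exists_insertAddr (D : TBTDiagram) (x : (ℕ → Bool) × ℤ) :
    ∃ i < D.n, ∃ y, x = insertAddr D.dom i y :=
  ⟨_, D.dom_leaves ▸ removeAddr_lt D.dom x, _, (insertAddr_removeAddr D.dom x).symm⟩

/-- Splitting a strand lengthens the addresses at both ends by the same letter, so neither the
prefix replacement nor the difference of lengths changes. Only the permutation of the braid enters.
-/
theorem act_split (D : TBTDiagram) {i : ℕ} (hi : i < D.n) (x : (ℕ → Bool) × ℤ) :
    (D.split i hi).act x = D.act x := by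
  obtain ⟨j, hj, ⟨ξ, k⟩, rfl⟩ := D.exists_insertAddr x
  have hi' : i < D.dom.numLeaves := by rwa [D.dom_leaves]
  have hj' : j < D.dom.numLeaves := by rwa [D.dom_leaves]
  have hpi : perm D.braid i < D.ran.numLeaves := by rwa [D.ran_leaves, perm_lt]
  have hpj : perm D.braid j < D.ran.numLeaves := by rwa [D.ran_leaves, perm_lt]
  rw [act_insertAddr D hj]
  by_cases hij : i = j
  · subst hij
    have h1 := insertAddr_attach_self hi' (fun k => ξ (k + 1)) (k - 1)
    have h2 := insertAddr_attach_self hpi (fun k => ξ (k + 1)) (k - 1)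
    have hξ := seqCons_zero_shift ξ
    have hp := perm_split_self D.braid i
    cases h : ξ 0 with
    | false =>
      rw [h] at hξ
      rw [hξ, sub_add_cancel] at h1 h2
      rw [← h1.1, ← h2.1]
      refine ((D.split i hi).act_insertAddr (i := i) (Nat.lt_succ_of_lt hi) _).trans ?_
      simp only [split, hp]
    | true =>
      rw [h] at hξ
      rw [hξ, sub_add_cancel] at h1 h2
      rw [← h1.2, ← h2.2]
      refine ((D.split i hi).act_insertAddr (i := i + 1) (Nat.succ_lt_succ hi) _).trans ?_
      simp only [split, hp]
  · rw [← insertAddr_attach_up hi' hj' hij,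
      ← insertAddr_attach_up hpi hpj ((perm D.braid).injective.ne hij), ← perm_split D.braid hij]
    exact (D.split i hi).act_insertAddr (i := up i j) (up_lt hj) _

theorem Comp.act {D E F : TBTDiagram} (h : Comp D E F) (x : (ℕ → Bool) × ℤ) :
    F.act x = E.act (D.act x) := by
  obtain ⟨i, hi, y, rfl⟩ := F.exists_insertAddr x
  obtain ⟨n, R, S, T, a, b, hR, hS, hT⟩ := h
  have hi' : i < n := hi
  rw [act_insertAddr _ hi]
  have h1 := act_insertAddr ⟨n, R, S, a, hR, hS⟩ hi' y
  have h2 := act_insertAddr ⟨n, S, T, b, hS, hT⟩ (i := perm a i) ((perm_lt _ _).2 hi') y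
  simp only at h1 h2 ⊢
  rw [h1, h2, perm_mul]

end TBTDiagram

namespace BV

open Relation BraidGroup BVTree

/-- The (right) action of the group on pairs (infinite word, integer). -/
def act : BV → (ℕ → Bool) × ℤ → (ℕ → Bool) × ℤ :=
  Quot.lift TBTDiagram.act (by
    rintro D _ ⟨i, hi, rfl⟩
    funext x
    exact (D.act_split hi x).symm)

theorem act_mk (D : TBTDiagram) : act (mk D) = D.act := rfl

theorem act_mul (g h : BV) (x : (ℕ → Bool) × ℤ) : act (g * h) x = act h (act g x) := by
  obtain ⟨D, E, F, rfl, rfl, hF⟩ := exists_prod g h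
  rw [mk_mul hF]
  exact hF.act x

theorem act_one (x : (ℕ → Bool) × ℤ) : act 1 x = x := by
  change TBTDiagram.act _ x = x
  simp [TBTDiagram.act, idDiagram, removeAddr, insertAddr]

theorem act_inv_act (g : BV) (x : (ℕ → Bool) × ℤ) : act g (act g⁻¹ x) = x := by
  rw [← act_mul, inv_mul_cancel, act_one]

theorem abs_act_mk_snd_sub_le {D : TBTDiagram} (hD : D.n ≤ 4) (x : (ℕ → Bool) × ℤ) :
    |(act (mk D) x).2 - x.2| ≤ 3 := by
  obtain ⟨i, hi, y, rfl⟩ := D.exists_insertAddr x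
  rw [act_mk, D.act_insertAddr hi]
  have h1 := insertAddr_snd (T := D.dom) (i := i) (by rwa [D.dom_leaves]) y
  have h2 := insertAddr_snd (T := D.ran) (i := perm D.braid i) (by rwa [D.ran_leaves, perm_lt]) y
  rw [D.dom_leaves] at h1
  rw [D.ran_leaves] at h2
  rw [abs_le]
  omega

/-- The action is on the right, so an edge of the Cayley graph applies one more generator last,
wherever the previous ones have led. -/
theorem abs_act_snd_sub_le {a b : BV} (w : (SimpleGraph.mulCayley standardGenerators).Walk a b)
    (x : (ℕ → Bool) × ℤ) : |(act b x).2 - (act a x).2| ≤ 3 * w.length := by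
  induction w with
  | nil => simp
  | @cons a c b h p ih =>
    obtain ⟨D, rfl, hD⟩ := exists_mk_of_adj h
    have h1 := abs_act_mk_snd_sub_le hD (act a x)
    rw [← act_mul] at h1
    rw [SimpleGraph.Walk.length_cons]
    push_cast
    rw [abs_le] at *
    omega

/-- The infinite word of zeros. -/
abbrev zeros : ℕ → Bool := fun _ => false

theorem seqCons_zeros : seqCons false zeros = zeros := by
  funext k; cases k <;> rfl

/-- A single leaf `i` suffices for the evaluation at a point: the word enters at that leaf of `A`
and leaves at the same leaf of `B`. -/
theorem act_frac_of_eq {A B : BVTree} (h : A.numLeaves = B.numLeaves) {i : ℕ}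
    (hi : i < B.numLeaves) {x y z : (ℕ → Bool) × ℤ} (hy : insertAddr A i x = y)
    (hz : insertAddr B i x = z) : act (frac A B) y = z := by
  rw [← mk_one_eq_frac h rfl, act_mk, ← hy, ← hz]
  simpa using TBTDiagram.act_insertAddr ⟨_, A, B, 1, h, rfl⟩ hi x

theorem rot_nil : rot [] = x₀ :=
  (mk_one_eq_frac (A := leftTree []) (B := rightTree []) rfl rfl).symm

theorem act_x₀ (k : ℤ) : act x₀ (zeros, k) = (zeros, k - 1) := by
  rw [← rot_nil]
  refine act_frac_of_eq (numLeaves_leftTree _) (i := 0) (x := (zeros, k - 2)) (by decide) ?_ ?_ <;>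
  simp [insertAddr, leftTree, rightTree, seqCons_zeros] <;> ring

theorem act_rot_false (k : ℤ) : act (rot [false]) (zeros, k) = (zeros, k - 1) := by
  refine act_frac_of_eq (numLeaves_leftTree _) (i := 0) (x := (zeros, k - 3)) (by decide) ?_ ?_ <;>
  simp [insertAddr, leftTree, rightTree, seqCons_zeros] <;> ring

theorem act_rot_true (k : ℤ) :
    act (rot [true]) (seqCons true zeros, k) = (seqCons true zeros, k - 1) := by
  refine act_frac_of_eq (numLeaves_leftTree _) (i := 1) (x := (zeros, k - 3)) (by decide) ?_ ?_ <;>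
  simp [insertAddr, leftTree, rightTree, seqCons_zeros] <;> ring

theorem act_rot_true_zeros (k : ℤ) : act (rot [true]) (zeros, k) = (zeros, k) := by
  refine act_frac_of_eq (numLeaves_leftTree _) (i := 0) (x := (zeros, k - 1)) (by decide) ?_ ?_ <;>
  simp [insertAddr, leftTree, rightTree, seqCons_zeros]

theorem act_rot_false_true (k : ℤ) :
    act (rot [false]) (seqCons true zeros, k) = (seqCons true zeros, k) := by
  refine act_frac_of_eq (numLeaves_leftTree _) (i := 3) (x := (zeros, k - 1)) (by decide) ?_ ?_ <;>
  simp [insertAddr, leftTree, rightTree]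

end BV

/-! ### Paths in Cayley graphs that avoid balls about the identity -/

section Cayley

open SimpleGraph

variable {G : Type*} [Group G] {X : Set G}

theorem mulCayley_adj_mul {g s : G} (hs : s ∈ X) (h : s ≠ 1) : (mulCayley X).Adj g (g * s) := by
  rw [mulCayley_adj]
  exact ⟨by simpa using h, Or.inl (by simpa using hs)⟩

/-- Left translation as a homomorphism of the Cayley graph. -/
def mulCayleyHom (X : Set G) (a : G) : mulCayley X →g mulCayley X where
  toFun g := a * g
  map_rel' h := mulCayley_adj_mul_iff_right.2 h

theorem mulCayley_reachable_mul {a g h : G} (H : (mulCayley X).Reachable g h) :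
    (mulCayley X).Reachable (a * g) (a * h) :=
  H.map (mulCayleyHom X a)

theorem mulCayley_connected (hX : Subgroup.closure X = ⊤) : (mulCayley X).Connected := by
  have h : ∀ g : G, (mulCayley X).Reachable 1 g := by
    intro g
    have hg : g ∈ Subgroup.closure X := by rw [hX]; trivial
    induction hg using Subgroup.closure_induction with
    | mem s hs =>
      by_cases h : s = 1
      · rw [h]
      · simpa using (mulCayley_adj_mul (g := 1) hs h).reachable
    | one => exact Reachable.refl _
    | mul a b _ _ ha hb =>
      have := mulCayley_reachable_mul (a := a) hb
      rw [mul_one] at this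
      exact ha.trans this
    | inv a _ ha => simpa using (mulCayley_reachable_mul (a := a⁻¹) ha).symm
  exact { preconnected := fun a b => (h a).symm.trans (h b), nonempty := ⟨1⟩ }

/-- The word norm. -/
noncomputable def wordNorm (X : Set G) (g : G) : ℕ := (mulCayley X).dist 1 g

theorem dist_mul_left_le (hX : Subgroup.closure X = ⊤) (a g h : G) :
    (mulCayley X).dist (a * g) (a * h) ≤ (mulCayley X).dist g h := by
  obtain ⟨w, hw⟩ := (mulCayley_connected hX).exists_walk_length_eq_dist g h
  rw [← hw, ← Walk.length_map (mulCayleyHom X a) w]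
  exact dist_le _

theorem dist_eq_wordNorm (hX : Subgroup.closure X = ⊤) (g h : G) :
    (mulCayley X).dist g h = wordNorm X (g⁻¹ * h) := by
  refine le_antisymm ?_ ?_
  · simpa [wordNorm] using dist_mul_left_le hX g 1 (g⁻¹ * h)
  · simpa [wordNorm] using dist_mul_left_le hX g⁻¹ g h

@[simp] theorem wordNorm_one : wordNorm X (1 : G) = 0 := dist_self

theorem wordNorm_pos (hX : Subgroup.closure X = ⊤) {g : G} (h : g ≠ 1) : 0 < wordNorm X g :=
  (mulCayley_connected hX).pos_dist_of_ne h.symm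

theorem wordNorm_inv (hX : Subgroup.closure X = ⊤) (g : G) : wordNorm X g⁻¹ = wordNorm X g := by
  have := dist_eq_wordNorm hX g 1
  rw [mul_one, dist_comm] at this
  exact this.symm

theorem wordNorm_mul_le (hX : Subgroup.closure X = ⊤) (g h : G) :
    wordNorm X (g * h) ≤ wordNorm X g + wordNorm X h := by
  have := (mulCayley_connected hX).dist_triangle (u := 1) (v := g) (w := g * h)
  rwa [dist_eq_wordNorm hX g, inv_mul_cancel_left] at this

theorem wordNorm_le_mul_add (hX : Subgroup.closure X = ⊤) (g h : G) :
    wordNorm X g ≤ wordNorm X (g * h) + wordNorm X h := by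
  have := wordNorm_mul_le hX (g * h) h⁻¹
  rwa [mul_inv_cancel_right, wordNorm_inv hX] at this

theorem wordNorm_pow_le (hX : Subgroup.closure X = ⊤) (g : G) (m : ℕ) :
    wordNorm X (g ^ m) ≤ m * wordNorm X g := by
  induction m with
  | zero => simp
  | succ m ih =>
    rw [pow_succ, add_mul, one_mul]
    exact (wordNorm_mul_le hX _ _).trans (by omega)

theorem wordNorm_le_one {s : G} (hs : s ∈ X) : wordNorm X s ≤ 1 := by
  by_cases h : s = 1
  · simp [h]
  · have := mulCayley_adj_mul (g := 1) hs h
    rw [one_mul] at this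
    exact (dist_eq_one_iff_adj.2 this).le

/-- `FarJoined X r ℓ g h`: there is a path of length at most `ℓ` from `g` to `h` whose vertices
have word norm at least `r`. -/
def FarJoined (X : Set G) (r ℓ : ℕ) (g h : G) : Prop :=
  ∃ w : (mulCayley X).Walk g h, w.length ≤ ℓ ∧ ∀ v ∈ w.support, r ≤ wordNorm X v

namespace FarJoined

variable {r ℓ ℓ' : ℕ} {g h k : G}

theorem refl (hg : r ≤ wordNorm X g) : FarJoined X r 0 g g := ⟨.nil, by simp, by simpa⟩

theorem mono (H : FarJoined X r ℓ g h) (hl : ℓ ≤ ℓ') : FarJoined X r ℓ' g h := by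
  obtain ⟨w, h1, h2⟩ := H
  exact ⟨w, h1.trans hl, h2⟩

theorem symm (H : FarJoined X r ℓ g h) : FarJoined X r ℓ h g := by
  obtain ⟨w, h1, h2⟩ := H
  exact ⟨w.reverse, by simpa, by simpa⟩

theorem trans (H : FarJoined X r ℓ g h) (H' : FarJoined X r ℓ' h k) :
    FarJoined X r (ℓ + ℓ') g k := by
  obtain ⟨w, h1, h2⟩ := H
  obtain ⟨w', h3, h4⟩ := H'
  refine ⟨w.append w', by rw [Walk.length_append]; omega, fun v hv => ?_⟩
  rcases Walk.mem_support_append_iff _ _ |>.1 hv with hv | hv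
  · exact h2 v hv
  · exact h4 v hv

theorem edge {s : G} (hs : s ∈ X ∨ s⁻¹ ∈ X) (h1 : r ≤ wordNorm X g)
    (h2 : r ≤ wordNorm X (g * s)) : FarJoined X r 1 g (g * s) := by
  by_cases h : s = 1
  · subst h
    rw [mul_one]
    exact (refl h1).mono (by omega)
  · have hadj : (mulCayley X).Adj g (g * s) := by
      rw [mulCayley_adj]
      exact ⟨by simpa using h, by simpa using hs⟩
    refine ⟨hadj.toWalk, by simp, fun v hv => ?_⟩
    simp only [Walk.support_cons, Walk.support_nil, List.mem_cons, List.not_mem_nil, or_false] at hv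
    rcases hv with rfl | rfl <;> assumption

/-- A geodesic that starts far away from the identity. -/
theorem mul (hX : Subgroup.closure X = ⊤) {a : G} (H : r + wordNorm X a ≤ wordNorm X g) :
    FarJoined X r (wordNorm X a) g (g * a) := by
  classical
  obtain ⟨w, hw⟩ := (mulCayley_connected hX).exists_walk_length_eq_dist g (g * a)
  rw [dist_eq_wordNorm hX, inv_mul_cancel_left] at hw
  refine ⟨w, hw.le, fun v hv => ?_⟩
  have h1 : (mulCayley X).dist g v ≤ wordNorm X a :=
    (dist_le (w.takeUntil v hv)).trans ((w.length_takeUntil_le_length hv).trans hw.le)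
  have h2 := (mulCayley_connected hX).dist_triangle (u := 1) (v := v) (w := g)
  rw [dist_comm (u := v)] at h2
  change wordNorm X g ≤ wordNorm X v + _ at h2
  omega

/-- A geodesic that ends far away from the identity. -/
theorem mul' (hX : Subgroup.closure X = ⊤) {a : G} (H : r + wordNorm X a ≤ wordNorm X (g * a)) :
    FarJoined X r (wordNorm X a) g (g * a) := by
  have := mul hX (g := g * a) (a := a⁻¹) (r := r) (by rwa [wordNorm_inv hX])
  rw [mul_inv_cancel_right, wordNorm_inv hX] at this
  exact this.symm

theorem pow_of_step {y : G} (m : ℕ) (hg : r ≤ wordNorm X g)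
    (H : ∀ i < m, FarJoined X r ℓ (g * y ^ i) (g * y ^ i * y)) :
    FarJoined X r (m * ℓ) g (g * y ^ m) := by
  induction m with
  | zero => simpa using refl hg
  | succ m ih =>
    have := (ih fun i hi => H i (by omega)).trans (H m (by omega))
    rw [pow_succ, ← mul_assoc, add_mul, one_mul]
    exact this

theorem pow (hX : Subgroup.closure X = ⊤) {y : G} {L : ℕ} (m : ℕ) (hy : wordNorm X y ≤ L)
    (H : ∀ i ≤ m, r + L ≤ wordNorm X (g * y ^ i)) :
    FarJoined X r (m * L) g (g * y ^ m) := by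
  refine pow_of_step m ?_ fun i hi => (mul hX ?_).mono hy
  · have := H 0 (by omega)
    rw [pow_zero, mul_one] at this
    omega
  · exact le_trans (by omega) (H i hi.le)

/-- A path along powers of an element `y` that increase the norm eventually. -/
theorem ray (hX : Subgroup.closure X = ⊤) {y : G} {L : ℕ} (m : ℕ) (hy : wordNorm X y ≤ L)
    (hg : (1 + 3 * L) * (r + L) ≤ wordNorm X g)
    (H : ∀ i : ℕ, i ≤ 3 * wordNorm X (g * y ^ i)) : FarJoined X r (m * L) g (g * y ^ m) := by
  refine pow hX m hy fun i _ => ?_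
  have h1 := wordNorm_le_mul_add hX g (y ^ i)
  have h2 := (wordNorm_pow_le hX y i).trans (Nat.mul_le_mul_left i hy)
  have h3 := Nat.mul_le_mul_right L (H i)
  -- The estimates combine to |g| ≤ |g yⁱ| + iL ≤ (1 + 3L)|g yⁱ|, which contradicts `hg`.
  by_contra! h
  nlinarith

/-- A path from an element `c` to a power of an element that commutes with `c`. -/
theorem of_commute (hX : Subgroup.closure X = ⊤) {c f y : G} {F L m : ℕ}
    (hf : wordNorm X f ≤ F) (hy : wordNorm X y ≤ L) (hc : Commute c (f * y * f⁻¹))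
    (H : ∀ i : ℕ, i ≤ 3 * wordNorm X (c * f * y ^ i))
    (h1 : (1 + 3 * L) * (r + L) + F ≤ wordNorm X c) (h2 : 3 * (r + F + wordNorm X c) ≤ m) :
    FarJoined X r (2 * F + m * L + wordNorm X c) c (f * y ^ m * f⁻¹) ∧
      m ≤ 3 * (wordNorm X (f * y ^ m * f⁻¹) + F + wordNorm X c) ∧
      wordNorm X (f * y ^ m * f⁻¹) ≤ 2 * F + m * L := by
  have hf' := wordNorm_inv hX f
  have hm := H m
  have e : c * f * y ^ m * f⁻¹ = f * y ^ m * f⁻¹ * c := by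
    have := (hc.pow_right m).eq
    rw [conj_pow] at this
    rw [← this]; group
  have h3 := wordNorm_le_mul_add hX (c * f * y ^ m) f⁻¹
  have h4 := wordNorm_mul_le hX (f * y ^ m * f⁻¹) c
  have h5 : r ≤ (1 + 3 * L) * (r + L) := by nlinarith
  rw [e] at h3
  refine ⟨?_, by omega, ?_⟩
  · have p1 : FarJoined X r F c (c * f) := (mul hX (by omega)).mono hf
    have p2 : FarJoined X r (m * L) (c * f) (c * f * y ^ m) := by
      refine ray hX m hy ?_ H
      have := wordNorm_le_mul_add hX c f
      omega
    have p3 : FarJoined X r F (c * f * y ^ m) (c * f * y ^ m * f⁻¹) :=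
      (mul hX (by omega)).mono (by omega)
    have p4 : FarJoined X r (wordNorm X c) (f * y ^ m * f⁻¹) (f * y ^ m * f⁻¹ * c) :=
      mul' hX (by omega)
    rw [e] at p3
    exact (((p1.trans p2).trans p3).trans p4.symm).mono (by omega)
  · have h6 := wordNorm_mul_le hX (f * y ^ m) f⁻¹
    have h7 := wordNorm_mul_le hX f (y ^ m)
    have h8 := (wordNorm_pow_le hX y m).trans (Nat.mul_le_mul_left m hy)
    omega

end FarJoined

end Cayley

/-! ### Escaping rays and detours in the group -/

namespace BV

open SimpleGraph

theorem abs_act_snd_sub_le_wordNorm (g : BV) (x : (ℕ → Bool) × ℤ) :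
    |(act g x).2 - x.2| ≤ 3 * wordNorm standardGenerators g := by
  obtain ⟨w, hw⟩ := (mulCayley_connected closure_standardGenerators).exists_walk_length_eq_dist 1 g
  have := abs_act_snd_sub_le w x
  rwa [hw, act_one] at this

theorem act_pow {y : BV} {p : ℕ → Bool} {c : ℤ} (h : ∀ k, act y (p, k) = (p, k + c)) (i : ℕ)
    (k : ℤ) : act (y ^ i) (p, k) = (p, k + i * c) := by
  induction i with
  | zero => simp [act_one]
  | succ i ih => rw [pow_succ, act_mul, ih, h]; push_cast; congr 1; ring

theorem act_inv_of_shift {y : BV} {p : ℕ → Bool} {c : ℤ} (h : ∀ k, act y (p, k) = (p, k + c))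
    (k : ℤ) : act y⁻¹ (p, k) = (p, k + -c) := by
  have := h (k + -c)
  rw [neg_add_cancel_right] at this
  rw [← this, ← act_mul, mul_inv_cancel, act_one]

/-- If `y` shifts the integer over some word, then the positive or the negative powers of `y`
lead away from the identity. -/
theorem exists_ray {y : BV} {p : ℕ → Bool} (h : ∀ k, act y (p, k) = (p, k + -1)) (g : BV) :
    ∃ y', (y' = y ∨ y' = y⁻¹) ∧ ∀ i : ℕ, i ≤ 3 * wordNorm standardGenerators (g * y' ^ i) := by
  -- The point x is sent by g to integer 0 over p. The sign of its own integer decides whether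
  -- lowering or raising the integer afterwards adds to the change already made by g.
  set x := act g⁻¹ (p, 0) with hx
  have hg : act g x = (p, 0) := act_inv_act g _
  rcases le_total 0 x.2 with h0 | h0
  · refine ⟨y, Or.inl rfl, fun i => ?_⟩
    have := abs_act_snd_sub_le_wordNorm (g * y ^ i) x
    rw [act_mul, hg, act_pow h, abs_le] at this
    simp only at this
    omega
  · refine ⟨y⁻¹, Or.inr rfl, fun i => ?_⟩
    have := abs_act_snd_sub_le_wordNorm (g * y⁻¹ ^ i) x
    rw [act_mul, hg, act_pow (act_inv_of_shift h), abs_le] at this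
    simp only at this
    omega

theorem exists_rot_mul_wordNorm (g : BV) {u : List Bool}
    (hu : 3 * wordNorm standardGenerators g + 3 ≤ u.length) :
    ∃ v, u.length ≤ v.length + 3 * wordNorm standardGenerators g ∧ rot u * g = g * rot v := by
  obtain ⟨w, hw⟩ := (mulCayley_connected closure_standardGenerators).exists_walk_length_eq_dist 1 g
  change w.length = wordNorm _ g at hw
  rw [← hw] at hu ⊢
  obtain ⟨v, h1, h2⟩ := exists_rot_mul w hu
  exact ⟨v, h1, by simpa using h2⟩

/-- For every `g` there is a vertex `w` below the root such that `g * rot [w] * g⁻¹` commutes with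
the copy of `x₀` below a vertex on the right side of the tree. -/
theorem exists_commute_rot (g : BV) : ∃ a : Bool,
    Commute (g * rot [a] * g⁻¹)
      (rot (List.replicate (3 * wordNorm standardGenerators g + 3 + 1) true)) := by
  obtain ⟨v, h1, h2⟩ := exists_rot_mul_wordNorm g
    (u := List.replicate (3 * wordNorm standardGenerators g + 3 + 1) true) (by simp)
  rw [List.length_replicate] at h1
  have key (a : Bool) (h : Commute (rot [a]) (rot v)) : Commute (g * rot [a] * g⁻¹)
      (rot (List.replicate (3 * wordNorm standardGenerators g + 3 + 1) true)) := by
    rw [eq_mul_inv_of_mul_eq h2]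
    exact (Commute.conj_iff g).2 h
  -- The extra length 4 of u keeps v non-empty. Then `a` is chosen as the half of the tree that does
  -- not contain v.
  match v, h1 with
  | [], h1 => simp at h1
  | false :: v, _ => exact ⟨true, key true (rot_commute v []).symm⟩
  | true :: v, _ => exact ⟨false, key false (rot_commute [] v)⟩

theorem act_rot_singleton (a : Bool) :
    ∃ p : ℕ → Bool, ∀ k, act (rot [a]) (p, k) = (p, k + -1) := by
  cases a
  · exact ⟨_, act_rot_false⟩
  · exact ⟨_, act_rot_true⟩

/-- Each factor shifts the integer over a word that the other one fixes completely, so the two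
exponents are detected independently. -/
theorem le_wordNorm_rot_mul_rot {y₀ y₁ : BV} (h₀ : y₀ = rot [false] ∨ y₀ = (rot [false])⁻¹)
    (h₁ : y₁ = rot [true] ∨ y₁ = (rot [true])⁻¹) (i j : ℕ) :
    i ≤ 3 * wordNorm standardGenerators (y₀ ^ i * y₁ ^ j) ∧
      j ≤ 3 * wordNorm standardGenerators (y₀ ^ i * y₁ ^ j) := by
  have a0 : ∃ c : ℤ, |c| = 1 ∧ ∀ k, act y₀ (zeros, k) = (zeros, k + c) := by
    rcases h₀ with rfl | rfl
    · exact ⟨-1, by simp, act_rot_false⟩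
    · exact ⟨_, by simp, act_inv_of_shift (c := -1) act_rot_false⟩
  have a1 : ∀ k, act y₀ (seqCons true zeros, k) = (seqCons true zeros, k + 0) := by
    rcases h₀ with rfl | rfl
    · simpa using act_rot_false_true
    · simpa using act_inv_of_shift (c := 0) (by simpa using act_rot_false_true)
  have b0 : ∃ c : ℤ, |c| = 1 ∧
      ∀ k, act y₁ (seqCons true zeros, k) = (seqCons true zeros, k + c) := by
    rcases h₁ with rfl | rfl
    · exact ⟨-1, by simp, act_rot_true⟩
    · exact ⟨_, by simp, act_inv_of_shift (c := -1) act_rot_true⟩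
  have b1 : ∀ k, act y₁ (zeros, k) = (zeros, k + 0) := by
    rcases h₁ with rfl | rfl
    · simpa using act_rot_true_zeros
    · simpa using act_inv_of_shift (c := 0) (by simpa using act_rot_true_zeros)
  obtain ⟨c, hc, a0⟩ := a0
  obtain ⟨d, hd, b0⟩ := b0
  have h1 := abs_act_snd_sub_le_wordNorm (y₀ ^ i * y₁ ^ j) (zeros, 0)
  have h2 := abs_act_snd_sub_le_wordNorm (y₀ ^ i * y₁ ^ j) (seqCons true zeros, 0)
  rw [act_mul, act_pow a0, act_pow b1] at h1
  rw [act_mul, act_pow a1, act_pow b0] at h2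
  simp only [mul_zero, add_zero, zero_add, sub_zero, abs_mul, hc, hd, mul_one, Nat.abs_cast] at h1 h2
  omega

/-- The positive and the negative powers of `rot [false]` are joined by a path that takes a detour
through powers of `rot [true]`. -/
theorem farJoined_rot_inv_pow {L r M : ℕ} (h0 : wordNorm standardGenerators (rot [false]) ≤ L)
    (h1 : wordNorm standardGenerators (rot [true]) ≤ L) (hM : 3 * (r + L) ≤ M) :
    FarJoined standardGenerators r (4 * (M * L)) ((rot [false])⁻¹ ^ M) (rot [false] ^ M) := by
  have hX := closure_standardGenerators
  have hc : Commute (rot [false]) (rot [true]) := rot_commute [] []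
  have h0' : wordNorm standardGenerators (rot [false])⁻¹ ≤ L := by rwa [wordNorm_inv hX]
  have p (y₀ : BV) (h₀ : y₀ = rot [false] ∨ y₀ = (rot [false])⁻¹) :
      FarJoined standardGenerators r (M * L) (y₀ ^ M) (y₀ ^ M * rot [true] ^ M) :=
    .pow hX M h1 fun i _ => by
      have := (le_wordNorm_rot_mul_rot h₀ (Or.inl rfl) M i).1
      omega
  have q (y₀ : BV) (h₀ : y₀ = rot [false] ∨ y₀ = (rot [false])⁻¹) :
      FarJoined standardGenerators r (M * L) (rot [true] ^ M) (y₀ ^ M * rot [true] ^ M) := by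
    have hc' : Commute y₀ (rot [true]) := by
      rcases h₀ with rfl | rfl
      · exact hc
      · exact hc.inv_left
    rw [(hc'.pow_pow M M).eq]
    refine .pow hX M (by rcases h₀ with rfl | rfl <;> assumption) fun i _ => ?_
    have := (le_wordNorm_rot_mul_rot h₀ (Or.inl rfl) i M).2
    rw [(hc'.pow_pow i M).eq] at this
    omega
  exact ((((p _ (Or.inr rfl)).trans (q _ (Or.inr rfl)).symm).trans (q _ (Or.inl rfl))).trans
    (p _ (Or.inl rfl)).symm).mono (by omega)

/-- After i steps along x₀ or its inverse the norm is at least |g| - i and at least i/3, hence at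
least |g|/4. This is the source of the factor 4. As x₀ is a generator, each step is a single edge
and no safety margin is lost. -/
theorem exists_farJoined_ray {g : BV} {r : ℕ}
    (hr : 4 * r ≤ wordNorm standardGenerators g + 3) (m : ℕ) :
    ∃ g', FarJoined standardGenerators r m g g' ∧ m ≤ 3 * wordNorm standardGenerators g' ∧
      wordNorm standardGenerators g' ≤ wordNorm standardGenerators g + m := by
  have hX := closure_standardGenerators
  have hx0 : x₀ ∈ standardGenerators := by simp [standardGenerators]
  obtain ⟨y, hy, H⟩ := exists_ray act_x₀ g
  have hy1 : wordNorm standardGenerators y ≤ 1 := by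
    rcases hy with rfl | rfl
    · exact wordNorm_le_one hx0
    · rw [wordNorm_inv hX]; exact wordNorm_le_one hx0
  have hi (i : ℕ) : wordNorm standardGenerators (y ^ i) ≤ i :=
    (wordNorm_pow_le hX y i).trans (Nat.mul_le_mul_left i hy1) |>.trans (by omega)
  have hn (i : ℕ) : r ≤ wordNorm standardGenerators (g * y ^ i) := by
    have h1 := wordNorm_le_mul_add hX g (y ^ i)
    have h2 := hi i
    have h3 := H i
    omega
  refine ⟨g * y ^ m, ?_, H m, (wordNorm_mul_le hX _ _).trans (by have := hi m; omega)⟩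
  have := FarJoined.pow_of_step (X := standardGenerators) (r := r) (ℓ := 1) (g := g) (y := y) m
    (by simpa using hn 0) fun i _ => by
      refine .edge ?_ (hn i) ?_
      · rcases hy with rfl | rfl
        · exact Or.inl hx0
        · exact Or.inr (by simpa using hx0)
      · have := hn (i + 1)
        rwa [pow_succ, ← mul_assoc] at this
  rwa [mul_one] at this

/-- Every non-trivial element `g` is joined to a large power of `rot [false]` by a path of linear
length that avoids a ball of radius proportional to the norm of `g`. -/
theorem exists_farJoined_rot_pow : ∃ C : ℕ, 0 < C ∧ ∀ g : BV, g ≠ 1 → ∀ r M : ℕ,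
    4 * r ≤ wordNorm standardGenerators g + 3 → C * wordNorm standardGenerators g ≤ M →
      FarJoined standardGenerators r (C * M) g (rot [false] ^ M) := by
  have hX := closure_standardGenerators
  have hx0 : x₀ ∈ standardGenerators := by simp [standardGenerators]
  obtain ⟨L, hL0, hL1⟩ : ∃ L, wordNorm standardGenerators (rot [false]) ≤ L ∧
      wordNorm standardGenerators (rot [true]) ≤ L := ⟨_, le_max_left _ _, le_max_right _ _⟩
  have hL (a : Bool) {y : BV} (hy : y = rot [a] ∨ y = (rot [a])⁻¹) :
      wordNorm standardGenerators y ≤ L := by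
    rcases hy with rfl | rfl
    · cases a <;> assumption
    · rw [wordNorm_inv hX]; cases a <;> assumption
  -- With n the norm of g, `c₁ * n` is the norm that a ray needs at its start. The multiples of n by
  -- `c₂`, `c₃`, `c₄`, `c₅` bound |g'|, the exponent j of x₀, |c| and |z|. The exponents `κ * n` and
  -- `μ * n` are large enough to absorb the conjugators and still leave c and z with sufficient
  -- norm.
  obtain ⟨c₁, hc₁⟩ : ∃ c, c = (1 + 3 * L) * (1 + L) := ⟨_, rfl⟩
  obtain ⟨c₂, hc₂⟩ : ∃ c, c = 1 + 3 * c₁ := ⟨_, rfl⟩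
  obtain ⟨c₃, hc₃⟩ : ∃ c, c = 3 * c₂ + 3 := ⟨_, rfl⟩
  obtain ⟨κ, hκ⟩ : ∃ c, c = 3 * (1 + c₁ + c₂ + c₃) := ⟨_, rfl⟩
  obtain ⟨c₄, hc₄⟩ : ∃ c, c = 2 * c₂ + κ * L := ⟨_, rfl⟩
  obtain ⟨μ, hμ⟩ : ∃ c, c = 3 * (1 + c₁ + c₃ + c₄) := ⟨_, rfl⟩
  obtain ⟨c₅, hc₅⟩ : ∃ c, c = 2 * c₃ + μ * L := ⟨_, rfl⟩
  refine ⟨3 * c₁ + κ * L + c₂ + c₅ + c₄ + c₅ + 5 * L + 3 * (1 + c₅) + 3 * (1 + L), by omega,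
    fun g hg r M hr hM => ?_⟩
  have hn := wordNorm_pos hX hg
  generalize hgn : wordNorm standardGenerators g = n at *
  have hrn : r ≤ n := by omega
  have hrL : (1 + 3 * L) * (r + L) ≤ c₁ * n := by
    rw [hc₁, mul_assoc]
    exact Nat.mul_le_mul_left _ (by nlinarith)
  -- away from the identity
  obtain ⟨g', p₀, hg'1, hg'2⟩ := exists_farJoined_ray (g := g) (r := r) (by omega) (3 * (c₁ * n))
  rw [hgn] at hg'2
  have e₂ : c₂ * n = n + 3 * (c₁ * n) := by rw [hc₂]; ring
  have e₃ : c₃ * n = 3 * (c₂ * n) + 3 * n := by rw [hc₃]; ring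
  have eκ : κ * n = 3 * n + 3 * (c₁ * n) + 3 * (c₂ * n) + 3 * (c₃ * n) := by rw [hκ]; ring
  have e₄ : c₄ * n = 2 * (c₂ * n) + κ * n * L := by rw [hc₄]; ring
  have eμ : μ * n = 3 * n + 3 * (c₁ * n) + 3 * (c₃ * n) + 3 * (c₄ * n) := by rw [hμ]; ring
  have e₅ : c₅ * n = 2 * (c₃ * n) + μ * n * L := by rw [hc₅]; ring
  -- to a conjugate of a power of `rot [a]`
  obtain ⟨a, ha⟩ := exists_commute_rot g'
  obtain ⟨p, hp⟩ := act_rot_singleton a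
  obtain ⟨y, hy, H⟩ := exists_ray hp g'
  have p₁ : FarJoined standardGenerators r (κ * n * L) g' (g' * y ^ (κ * n)) :=
    .ray hX _ (hL a hy) (by omega) H
  have p₂ : FarJoined standardGenerators r (c₂ * n) (g' * y ^ (κ * n))
      (g' * y ^ (κ * n) * g'⁻¹) := by
    have := H (κ * n)
    exact (FarJoined.mul hX (by rw [wordNorm_inv hX]; omega)).mono
      (by rw [wordNorm_inv hX]; omega)
  obtain ⟨c, hc⟩ : ∃ c, c = g' * y ^ (κ * n) * g'⁻¹ := ⟨_, rfl⟩
  rw [← hc] at p₂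
  have hcl : κ * n ≤ 3 * (wordNorm standardGenerators c + c₂ * n) := by
    have h1 := H (κ * n)
    have h2 := wordNorm_le_mul_add hX (g' * y ^ (κ * n)) g'⁻¹
    rw [wordNorm_inv hX, ← hc] at h2
    omega
  have hcu : wordNorm standardGenerators c ≤ c₄ * n := by
    have h1 := wordNorm_mul_le hX (g' * y ^ (κ * n)) g'⁻¹
    have h2 := wordNorm_mul_le hX g' (y ^ (κ * n))
    have h3 := (wordNorm_pow_le hX y (κ * n)).trans (Nat.mul_le_mul_left _ (hL a hy))
    rw [wordNorm_inv hX, ← hc] at h1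
    omega
  -- to a power of a rotation on the right side of the tree
  obtain ⟨j, hj⟩ : ∃ j, j = 3 * wordNorm standardGenerators g' + 3 := ⟨_, rfl⟩
  rw [← hj, rot_true_cons] at ha
  -- Commutation passes from `rot [a]` to its power `y ^ (κ * n)`, whichever sign the ray has.
  have hcomm : Commute c ((x₀ ^ j)⁻¹ * rot [true] * x₀ ^ j) := by
    rw [hc, ← conj_pow]
    refine Commute.pow_left ?_ _
    rcases hy with rfl | rfl
    · exact ha
    · rw [← conj_inv]; exact ha.inv_left
  obtain ⟨y', hy', H'⟩ := exists_ray act_rot_true (c * (x₀ ^ j)⁻¹)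
  have hf : wordNorm standardGenerators (x₀ ^ j)⁻¹ ≤ c₃ * n := by
    rw [wordNorm_inv hX]
    refine ((wordNorm_pow_le hX x₀ j).trans (Nat.mul_le_mul_left _ (wordNorm_le_one hx0))).trans ?_
    omega
  obtain ⟨p₃, hz1, hz2⟩ := FarJoined.of_commute hX (c := c) (f := (x₀ ^ j)⁻¹) (y := y')
    (F := c₃ * n) (L := L) (m := μ * n) (r := r) hf (hL true hy') (by
      rw [inv_inv]
      rcases hy' with rfl | rfl
      · exact hcomm
      · have := hcomm.inv_right
        simpa [mul_assoc] using this) H' (by omega) (by omega)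
  obtain ⟨z, hz⟩ : ∃ z, z = (x₀ ^ j)⁻¹ * y' ^ (μ * n) * (x₀ ^ j)⁻¹⁻¹ := ⟨_, rfl⟩
  rw [← hz] at p₃ hz1 hz2
  -- to a power of `rot [false]`
  have hzc : Commute (rot [false]) z := by
    have h1 : Commute (rot [false]) ((x₀ ^ j)⁻¹ * rot [true] * (x₀ ^ j)⁻¹⁻¹) := by
      rw [inv_inv, ← rot_true_cons, List.replicate_succ]
      exact rot_commute _ _
    rw [hz, ← conj_pow]
    refine Commute.pow_right ?_ _
    rcases hy' with rfl | rfl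
    · exact h1
    · rw [← conj_inv]; exact h1.inv_right
  obtain ⟨y'', hy'', H''⟩ := exists_ray act_rot_false z
  have hnM : (3 * (1 + c₅)) * n + 3 * (1 + L) * n ≤ M :=
    le_trans (by rw [← add_mul]; exact Nat.mul_le_mul_right _ (by omega)) hM
  have hnM' : 3 * n + 3 * (c₅ * n) + (3 * n + 3 * (L * n)) ≤ M := by
    refine le_trans (le_of_eq ?_) hnM; ring
  have hLn : L ≤ L * n := Nat.le_mul_of_pos_right _ hn
  -- Here the commuting copy is `rot [false]` itself and no conjugator is needed, so the path ends
  -- at a plain power whose exponent M is prescribed.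
  obtain ⟨p₄, -, -⟩ := FarJoined.of_commute hX (c := z) (f := 1) (y := y'')
    (F := 0) (L := L) (m := M) (r := r) (by simp) (hL false hy'') (by
      rw [one_mul, inv_one, mul_one]
      rcases hy'' with rfl | rfl
      · exact hzc.symm
      · exact hzc.symm.inv_right) (by simpa using H'') (by omega) (by omega)
  rw [one_mul, inv_one, mul_one] at p₄
  have p₅ : FarJoined standardGenerators r (4 * (M * L)) (y'' ^ M) (rot [false] ^ M) := by
    rcases hy'' with rfl | rfl
    · refine (FarJoined.refl ?_).mono (Nat.zero_le _)
      have := (le_wordNorm_rot_mul_rot (Or.inl rfl) (Or.inl rfl) M 0).1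
      rw [pow_zero, mul_one] at this
      omega
    · exact farJoined_rot_inv_pow hL0 hL1 (by omega)
  refine (((((p₀.trans p₁).trans p₂).trans p₃).trans p₄).trans p₅).mono ?_
  have hnM'' : n ≤ M := by omega
  have hle : (3 * c₁ + κ * L + c₂ + c₅ + c₄ + c₅) * n + 5 * L * M ≤
      (3 * c₁ + κ * L + c₂ + c₅ + c₄ + c₅) * M + 5 * L * M := by gcongr
  calc _ ≤ (3 * c₁ + κ * L + c₂ + c₅ + c₄ + c₅) * n + 5 * L * M := by
        have e : (3 * c₁ + κ * L + c₂ + c₅ + c₄ + c₅) * n + 5 * L * M = 3 * (c₁ * n) + κ * n * L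
          + c₂ * n + c₅ * n + c₄ * n + c₅ * n + 5 * (M * L) := by ring
        omega
    _ ≤ _ := hle
    _ ≤ _ := by rw [← add_mul]; exact Nat.mul_le_mul_right _ (by omega)

end BV

/-! ### From far paths to linear divergence -/

section Divergence

open SimpleGraph

variable {G : Type*} [Group G] {X : Set G}

/-- The linear summand in the definition of domination absorbs any linear function, so only the
upper bound on the divergence has content. -/
theorem asympDominated_linear (f : ℝ≥0 → ℝ≥0∞) (a : ℝ≥0) :
    AsympDominated (fun x => (a : ℝ≥0∞) * x) f :=
  ⟨0, 0, 0, a, 0, fun x => by simp⟩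

theorem hasLinearDivergence_of_farJoined (hX : Subgroup.closure X = ⊤) {C : ℕ}
    (H : ∀ g h : G, g ≠ 1 → h ≠ 1 → ∀ r R : ℕ, 4 * r ≤ wordNorm X g + 3 →
      4 * r ≤ wordNorm X h + 3 → wordNorm X g ≤ R → wordNorm X h ≤ R → FarJoined X r (C * R) g h) :
    HasLinearDivergence X := by
  refine ⟨1 / 4, by norm_num, by norm_num, 1, one_pos, ⟨0, 0, 0, C, 0, fun x => ?_⟩,
    asympDominated_linear _ 1⟩
  simp only [ENNReal.coe_zero, zero_mul, zero_add, add_zero]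
  refine iSup₂_le fun g h => iSup₂_le fun hg hh => ?_
  change (wordNorm X g : ℝ) = x at hg
  change (wordNorm X h : ℝ) = x at hh
  obtain ⟨n, hn⟩ : ∃ n, n = wordNorm X g := ⟨_, rfl⟩
  have hnh : wordNorm X h = n := by rw [hn]; exact_mod_cast hh.trans hg.symm
  rw [← hn] at hg
  -- The presence of g forces x to be an integer. For other x the supremum is over an empty family.
  have hx : x = n := by ext; simpa using hg.symm
  rcases Nat.eq_zero_or_pos n with h0 | h0
  · have e (k : G) (hk : wordNorm X k = 0) : k = 1 := by
      by_contra hne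
      exact (wordNorm_pos hX hne).ne' hk
    obtain rfl := e g (by omega)
    obtain rfl := e h (by omega)
    refine iInf₂_le_of_le .nil (fun v _ => ?_) (by simp)
    rw [hx, h0]
    simp
  · have hne (k : G) (hk : wordNorm X k = n) : k ≠ 1 := by
      rintro rfl
      rw [wordNorm_one] at hk
      omega
    -- The radius `(n + 3) / 4` is n/4 rounded up, so the path avoids the ball of real radius n/4.
    obtain ⟨w, hw, hv⟩ := H g h (hne g hn.symm) (hne h hnh) ((n + 3) / 4) n (by omega) (by omega)
      (by omega) (by omega)
    refine iInf₂_le_of_le w (fun v hv' => ?_) ?_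
    · have h1 : n ≤ 4 * wordNorm X v := by have := hv v hv'; omega
      have h2 : (n : ℝ) ≤ 4 * wordNorm X v := by exact_mod_cast h1
      change _ ≤ (wordNorm X v : ℝ)
      rw [hx]
      push_cast
      linarith
    · rw [hx]
      exact_mod_cast hw

end Divergence

/-! ### Limits of paths in asymptotic cones -/

namespace SimpleGraph.Walk

variable {V : Type*} {Γ : SimpleGraph V} {u v : V}

theorem edist_getVert_add_le (w : Γ.Walk u v) (i k : ℕ) :
    Γ.edist (w.getVert i) (w.getVert (i + k)) ≤ k := by
  induction k with
  | zero => simp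
  | succ k ih =>
    refine (SimpleGraph.edist_triangle (v := w.getVert (i + k))).trans ?_
    push_cast
    refine add_le_add ih ?_
    rw [edist_le_one_iff_adj_or_eq]
    rcases lt_or_ge (i + k) w.length with h | h
    · exact Or.inl (w.adj_getVert_succ h)
    · right
      rw [w.getVert_of_length_le h, w.getVert_of_length_le (by omega)]

/-- The parametrization of a walk by the unit interval. -/
noncomputable def param (w : Γ.Walk u v) (t : ℝ) : V := w.getVert ⌊t * w.length⌋₊

theorem param_mem_support (w : Γ.Walk u v) (t : ℝ) : w.param t ∈ w.support :=
  w.getVert_mem_support _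

/-- The summand 1 is the rounding error of the parametrization; it vanishes after rescaling
(`limDist_le_of_eventually`). -/
theorem edist_param_le (w : Γ.Walk u v) {s t : ℝ} (hs : 0 ≤ s) (hst : s ≤ t) :
    (Γ.edist (w.param s) (w.param t) : ℝ≥0∞) ≤ ENNReal.ofReal (t - s) * w.length + 1 := by
  have hl : (0 : ℝ) ≤ w.length := by positivity
  have h1 : ⌊s * w.length⌋₊ ≤ ⌊t * w.length⌋₊ := Nat.floor_le_floor (by gcongr)
  obtain ⟨k, hk⟩ := Nat.exists_eq_add_of_le h1
  have h2 := w.edist_getVert_add_le ⌊s * w.length⌋₊ k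
  rw [← hk] at h2
  refine (ENat.toENNReal_le.2 h2).trans ?_
  have h3 : (⌊t * w.length⌋₊ : ℝ) ≤ t * w.length := Nat.floor_le (mul_nonneg (hs.trans hst) hl)
  have h4 := Nat.lt_floor_add_one (s * w.length)
  have h5 : (k : ℝ) ≤ (t - s) * w.length + 1 := by
    rw [hk] at h3
    push_cast at h3
    linarith
  rw [ENat.toENNReal_coe, ← ENNReal.ofReal_natCast k, ← ENNReal.ofReal_natCast w.length,
    ← ENNReal.ofReal_mul (by linarith), ← ENNReal.ofReal_one,
    ← ENNReal.ofReal_add (mul_nonneg (by linarith) hl) zero_le_one]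
  exact ENNReal.ofReal_le_ofReal h5

end SimpleGraph.Walk

namespace ConeData

open Filter Topology SimpleGraph

variable {V : Type*} (C : ConeData V) (Γ : SimpleGraph V)

theorem tendsto_inv_scale : Tendsto (fun n => (1 : ℝ≥0∞) / C.scale n) C.ω (𝓝 0) := by
  have h : Tendsto (fun n => ((C.scale n : ℝ≥0) : ℝ≥0∞)) C.ω (𝓝 ⊤) :=
    ENNReal.tendsto_coe_nhds_top.2 C.scale_tendsto
  simpa [one_div] using tendsto_inv_iff.2 h

variable {C Γ}

theorem limDist_comm (x y : ℕ → V) : C.limDist Γ x y = C.limDist Γ y x := by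
  have : C.scaledDist Γ x y = C.scaledDist Γ y x := by
    ext n; rw [scaledDist, scaledDist, SimpleGraph.edist_comm]
  rw [limDist, limDist, this]

theorem limDist_triangle (x y z : ℕ → V) :
    C.limDist Γ x z ≤ C.limDist Γ x y + C.limDist Γ y z := by
  refine le_of_tendsto_of_tendsto' (C.tendsto_limDist Γ x z)
    ((C.tendsto_limDist Γ x y).add (C.tendsto_limDist Γ y z)) fun n => ?_
  simp only [scaledDist]
  rw [← ENNReal.add_div, ← ENat.toENNReal_add]
  exact ENNReal.div_le_div_right (ENat.toENNReal_le.2 SimpleGraph.edist_triangle) _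

theorem edist_admissible_ne_top (x y : C.Admissible Γ) : edist x y ≠ ⊤ := by
  refine ne_top_of_le_ne_top (ENNReal.add_ne_top.2 ⟨x.2, y.2⟩) ?_
  rw [limDist_comm y.1]
  exact limDist_triangle _ _ _

theorem limDist_le_of_eventually {x y : ℕ → V} {a : ℝ≥0∞}
    (h : ∀ᶠ n in C.ω, (Γ.edist (x n) (y n) : ℝ≥0∞) ≤ a * C.scale n + 1) :
    C.limDist Γ x y ≤ a := by
  have h1 : Tendsto (fun n => a + 1 / C.scale n) C.ω (𝓝 (a + 0)) :=
    tendsto_const_nhds.add C.tendsto_inv_scale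
  rw [add_zero] at h1
  refine le_of_tendsto_of_tendsto (C.tendsto_limDist Γ x y) h1 (h.mono fun n hn => ?_)
  have hs : (C.scale n : ℝ≥0∞) ≠ 0 := by simpa using (C.scale_pos n).ne'
  rw [scaledDist, ENNReal.div_le_iff hs ENNReal.coe_ne_top, add_mul,
    ENNReal.div_mul_cancel hs ENNReal.coe_ne_top]
  exact hn

theorem le_limDist_of_eventually {x y : ℕ → V} {a : ℝ≥0∞}
    (h : ∀ᶠ n in C.ω, a * C.scale n ≤ (Γ.edist (x n) (y n) : ℝ≥0∞)) :
    a ≤ C.limDist Γ x y := by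
  refine le_of_tendsto_of_tendsto tendsto_const_nhds (C.tendsto_limDist Γ x y)
    (h.mono fun n hn => ?_)
  have hs : (C.scale n : ℝ≥0∞) ≠ 0 := by simpa using (C.scale_pos n).ne'
  rw [scaledDist, ENNReal.le_div_iff_mul_le (Or.inl hs) (Or.inl ENNReal.coe_ne_top)]
  exact hn

/-- The limit of paths of linear length is a connected set in the asymptotic cone. If the paths
avoid balls of linear radius, then this set avoids the limit of the centers. -/
theorem exists_isPreconnected_of_walks (hΓ : Γ.Connected) (x y p : C.Admissible Γ) {D : ℝ≥0}
    {ε : ℝ≥0∞} (hε : ε ≠ 0)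
    (H : ∀ᶠ n in C.ω, ∃ w : Γ.Walk (x.1 n) (y.1 n), (w.length : ℝ≥0∞) ≤ D * C.scale n ∧
      ∀ v ∈ w.support, ε * C.scale n ≤ (Γ.edist v (p.1 n) : ℝ≥0∞)) :
    ∃ t : Set (C.Cone Γ), t ⊆ {SeparationQuotient.mk p}ᶜ ∧ SeparationQuotient.mk x ∈ t ∧
      SeparationQuotient.mk y ∈ t ∧ IsPreconnected t := by
  -- A walk is chosen for every n. Outside the set of good indices, which belongs to the
  -- ultrafilter, an arbitrary walk serves as a default.
  have H' : ∀ n, ∃ w : Γ.Walk (x.1 n) (y.1 n),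
      (∃ w : Γ.Walk (x.1 n) (y.1 n), (w.length : ℝ≥0∞) ≤ D * C.scale n ∧
        ∀ v ∈ w.support, ε * C.scale n ≤ (Γ.edist v (p.1 n) : ℝ≥0∞)) →
      (w.length : ℝ≥0∞) ≤ D * C.scale n ∧
        ∀ v ∈ w.support, ε * C.scale n ≤ (Γ.edist v (p.1 n) : ℝ≥0∞) := by
    intro n
    by_cases h : ∃ w : Γ.Walk (x.1 n) (y.1 n), (w.length : ℝ≥0∞) ≤ D * C.scale n ∧
        ∀ v ∈ w.support, ε * C.scale n ≤ (Γ.edist v (p.1 n) : ℝ≥0∞)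
    · obtain ⟨w, hw⟩ := h
      exact ⟨w, fun _ => hw⟩
    · obtain ⟨w⟩ := hΓ.preconnected (x.1 n) (y.1 n)
      exact ⟨w, fun h' => absurd h' h⟩
  choose w hw using H'
  have hev : ∀ᶠ n in C.ω, ((w n).length : ℝ≥0∞) ≤ D * C.scale n ∧
      ∀ v ∈ (w n).support, ε * C.scale n ≤ (Γ.edist v (p.1 n) : ℝ≥0∞) := H.mono hw
  have hlip {s t : ℝ} (hs : 0 ≤ s) (hst : s ≤ t) :
      C.limDist Γ (fun n => (w n).param s) (fun n => (w n).param t) ≤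
        ENNReal.ofReal (t - s) * D := by
    refine limDist_le_of_eventually (hev.mono fun n hn => ?_)
    refine ((w n).edist_param_le hs hst).trans ?_
    rw [mul_assoc]
    gcongr
    exact hn.1
  have h0 : (fun n => (w n).param 0) = x.1 := by funext n; simp [Walk.param]
  have h1 : (fun n => (w n).param 1) = y.1 := by funext n; simp [Walk.param]
  have hadm (t : unitInterval) : C.limDist Γ (fun n => (w n).param t) C.base ≠ ⊤ := by
    have a1 := hlip le_rfl t.2.1
    rw [h0, limDist_comm] at a1
    refine ne_top_of_le_ne_top (ENNReal.add_ne_top.2 ⟨?_, x.2⟩) (limDist_triangle _ x.1 _)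
    exact ne_top_of_le_ne_top (ENNReal.mul_ne_top ENNReal.ofReal_ne_top ENNReal.coe_ne_top) a1
  -- The limit of the parametrized walks is Lipschitz with constant `D`, hence its image is
  -- connected.
  let f : unitInterval → C.Admissible Γ := fun t => ⟨fun n => (w n).param t, hadm t⟩
  have hf : LipschitzWith D f := by
    have key {s t : unitInterval} (hst : s ≤ t) : edist (f s) (f t) ≤ D * edist s t := by
      refine (hlip s.2.1 hst).trans (le_of_eq ?_)
      have hst' : (s : ℝ) ≤ t := hst
      rw [mul_comm, Subtype.edist_eq, PseudoEMetricSpace.edist_comm, edist_dist, Real.dist_eq,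
        abs_of_nonneg (sub_nonneg.2 hst')]
    intro s t
    rcases le_total s t with h | h
    · exact key h
    · rw [PseudoEMetricSpace.edist_comm, PseudoEMetricSpace.edist_comm s]
      exact key h
  refine ⟨Set.range fun t => SeparationQuotient.mk (f t), ?_, ⟨0, ?_⟩, ⟨1, ?_⟩,
    isPreconnected_range (SeparationQuotient.continuous_mk.comp hf.continuous)⟩
  · rintro _ ⟨t, rfl⟩ h
    rw [Set.mem_singleton_iff, SeparationQuotient.mk_eq_mk, EMetric.inseparable_iff] at h
    have : ε ≤ edist (f t) p :=
      le_limDist_of_eventually (hev.mono fun n hn => hn.2 _ ((w n).param_mem_support _))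
    rw [h] at this
    exact hε (le_zero_iff.1 this)
  · exact congrArg _ (Subtype.ext h0)
  · exact congrArg _ (Subtype.ext h1)


theorem eventually_edist_le {x y : C.Admissible Γ} {a : ℝ≥0∞} (h : edist x y < a) :
    ∀ᶠ n in C.ω, (Γ.edist (x.1 n) (y.1 n) : ℝ≥0∞) ≤ a * C.scale n := by
  refine ((C.tendsto_limDist Γ x.1 y.1).eventually (gt_mem_nhds h)).mono fun n hn => ?_
  have hs : (C.scale n : ℝ≥0∞) ≠ 0 := by simpa using (C.scale_pos n).ne'
  exact (ENNReal.div_le_iff hs ENNReal.coe_ne_top).1 hn.le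

theorem eventually_le_edist {x y : C.Admissible Γ} {a : ℝ≥0∞} (h : a < edist x y) :
    ∀ᶠ n in C.ω, a * C.scale n ≤ (Γ.edist (x.1 n) (y.1 n) : ℝ≥0∞) := by
  refine ((C.tendsto_limDist Γ x.1 y.1).eventually (lt_mem_nhds h)).mono fun n hn => ?_
  have hs : (C.scale n : ℝ≥0∞) ≠ 0 := by simpa using (C.scale_pos n).ne'
  exact (ENNReal.le_div_iff_mul_le (Or.inl hs) (Or.inl ENNReal.coe_ne_top)).1 hn.le

end ConeData

theorem edist_eq_wordNorm {G : Type*} [Group G] {X : Set G} (hX : Subgroup.closure X = ⊤)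
    (g h : G) : ((SimpleGraph.mulCayley X).edist g h : ℝ≥0∞) = wordNorm X (h⁻¹ * g) := by
  rw [← dist_eq_wordNorm hX, SimpleGraph.edist_comm,
    ← ((mulCayley_connected hX).preconnected h g).coe_dist_eq_edist, ENat.toENNReal_coe]

/-- Left translation moves the n-th term of p to the identity. The translated terms of x and y then
have norms between fixed positive multiples of the scale, so far paths between them have linear
length and avoid a ball of linear radius. -/
theorem not_isCutPoint_of_farJoined {G : Type*} [Group G] {X : Set G}
    (hX : Subgroup.closure X = ⊤) {C : ℕ}
    (H : ∀ g h : G, g ≠ 1 → h ≠ 1 → ∀ r R : ℕ, 4 * r ≤ wordNorm X g + 3 →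
      4 * r ≤ wordNorm X h + 3 → wordNorm X g ≤ R → wordNorm X h ≤ R → FarJoined X r (C * R) g h)
    (K : ConeData G) (p : K.Cone (SimpleGraph.mulCayley X)) : ¬ IsCutPoint p := by
  rw [IsCutPoint, not_not]
  obtain ⟨p, rfl⟩ := SeparationQuotient.surjective_mk p
  refine isPreconnected_of_forall_pair fun x hx y hy => ?_
  obtain ⟨x, rfl⟩ := SeparationQuotient.surjective_mk x
  obtain ⟨y, rfl⟩ := SeparationQuotient.surjective_mk y
  have hpos {z : K.Admissible (SimpleGraph.mulCayley X)}
      (hz : SeparationQuotient.mk z ∈ ({SeparationQuotient.mk p}ᶜ : Set (K.Cone _))) :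
      0 < edist z p := by
    rw [pos_iff_ne_zero]
    intro h
    exact hz (SeparationQuotient.mk_eq_mk.2 (EMetric.inseparable_iff.2 h))
  obtain ⟨ε, hε0, hε⟩ := exists_between (lt_min (hpos hx) (hpos hy))
  obtain ⟨D, hD⟩ := ENNReal.lt_iff_exists_nnreal_btwn.1
    (max_lt (ConeData.edist_admissible_ne_top x p).lt_top
      (ConeData.edist_admissible_ne_top y p).lt_top)
  have hε4 : ε / 4 ≠ 0 := (ENNReal.div_pos hε0.ne' (by simp)).ne'
  refine ConeData.exists_isPreconnected_of_walks (D := C * (D + 1)) (mulCayley_connected hX) x y p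
    hε4 ?_
  filter_upwards [ConeData.eventually_le_edist (hε.trans_le (min_le_left _ _)),
    ConeData.eventually_le_edist (hε.trans_le (min_le_right _ _)),
    ConeData.eventually_edist_le ((le_max_left _ _).trans_lt hD.1),
    ConeData.eventually_edist_le ((le_max_right _ _).trans_lt hD.1),
    K.scale_tendsto.eventually_ge_atTop 1] with n h1 h2 h3 h4 h5
  rw [edist_eq_wordNorm hX] at h1 h2 h3 h4
  set s := K.scale n with hs
  have hs0 : (s : ℝ≥0∞) ≠ 0 := by simpa using (K.scale_pos n).ne'
  generalize hg : (p.1 n)⁻¹ * x.1 n = g at *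
  generalize hh : (p.1 n)⁻¹ * y.1 n = h at *
  have hne (k : G) (hk : ε * s ≤ wordNorm X k) : k ≠ 1 := by
    rintro rfl
    rw [wordNorm_one, Nat.cast_zero, le_zero_iff, mul_eq_zero] at hk
    exact hk.elim hε0.ne' hs0
  -- The two norms may differ. The smaller one determines the avoided radius, and their common upper
  -- bound determines the length.
  obtain ⟨N, hN⟩ : ∃ N, N = min (wordNorm X g) (wordNorm X h) := ⟨_, rfl⟩
  have hεN : ε * s ≤ N := by
    rcases min_choice (wordNorm X g) (wordNorm X h) with e | e <;> rw [hN, e] <;> assumption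
  have hfloor (k : G) (hk : (wordNorm X k : ℝ≥0∞) ≤ D * s) : wordNorm X k ≤ ⌊D * s⌋₊ :=
    Nat.le_floor (by exact_mod_cast hk)
  obtain ⟨w, hw1, hw2⟩ := H g h (hne g h1) (hne h h2) ((N + 3) / 4) ⌊D * s⌋₊ (by omega) (by omega)
    (hfloor g h3) (hfloor h h4)
  refine ⟨(w.map (mulCayleyHom X (p.1 n))).copy ?_ ?_, ?_, fun v hv => ?_⟩
  · rw [← hg]; simp [mulCayleyHom]
  · rw [← hh]; simp [mulCayleyHom]
  · rw [SimpleGraph.Walk.length_copy, SimpleGraph.Walk.length_map]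
    have h6 : (w.length : ℝ≥0) ≤ C * (D + 1) * s := by
      calc (w.length : ℝ≥0) ≤ C * ⌊D * s⌋₊ := by exact_mod_cast hw1
        _ ≤ C * (D * s) := by gcongr; exact Nat.floor_le (by positivity)
        _ ≤ _ := by rw [mul_assoc]; gcongr; simp
    exact_mod_cast h6
  · rw [SimpleGraph.Walk.support_copy, SimpleGraph.Walk.support_map, List.mem_map] at hv
    obtain ⟨u, hu, rfl⟩ := hv
    have h7 := hw2 u hu
    have h8 : (N : ℝ≥0∞) ≤ wordNorm X u * 4 := by
      have : N ≤ wordNorm X u * 4 := by omega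
      exact_mod_cast this
    rw [edist_eq_wordNorm hX]
    simp only [mulCayleyHom, RelHom.coeFn_mk, inv_mul_cancel_left]
    rw [ENNReal.mul_comm_div, ← mul_div_assoc]
    exact ENNReal.div_le_of_le_mul (hεN.trans h8)

/-- Both elements are joined to the same power `rot [false] ^ (C * R)`. The freedom in the exponent
M of `exists_farJoined_rot_pow` makes this possible for elements of different norms. -/
theorem BV.exists_farJoined : ∃ C : ℕ, ∀ g h : BV, g ≠ 1 → h ≠ 1 → ∀ r R : ℕ,
    4 * r ≤ wordNorm standardGenerators g + 3 → 4 * r ≤ wordNorm standardGenerators h + 3 →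
      wordNorm standardGenerators g ≤ R → wordNorm standardGenerators h ≤ R →
        FarJoined standardGenerators r (C * R) g h := by
  obtain ⟨C, -, H⟩ := exists_farJoined_rot_pow
  refine ⟨2 * C * C, fun g h hg hh r R hr hr' hR hR' => ?_⟩
  have h1 := H g hg r (C * R) hr (Nat.mul_le_mul_left _ hR)
  have h2 := H h hh r (C * R) hr' (Nat.mul_le_mul_left _ hR')
  exact (h1.trans h2.symm).mono (le_of_eq (by ring))

theorem theorem1 :
    Subgroup.closure BV.standardGenerators = ⊤ ∧
    HasLinearDivergence BV.standardGenerators ∧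
    ∀ (C : ConeData BV) (p : C.Cone (SimpleGraph.mulCayley BV.standardGenerators)),
      ¬ IsCutPoint p := by
  obtain ⟨C, H⟩ := BV.exists_farJoined
  exact ⟨BV.closure_standardGenerators,
    hasLinearDivergence_of_farJoined BV.closure_standardGenerators H,
    not_isCutPoint_of_farJoined BV.closure_standardGenerators H⟩
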